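/- Let $N\ge 3$ and $d_1,\dots,d_N\ge 2$ be integers, and put $d_T=\prod_{j=1}^N d_j$ and $d_S=\sum_{j=1}^N d_j$. Write $\log$ for the logarithm to base $2$ and $\ln$ for the natural logarithm. For an $N$-partite state (density matrix) $\rho$ on $\bigotimes_{j=1}^N\mathcal H_j$, with finite-dimensional $\mathcal H_j$, let $\Lambda^2(\rho)=\max\langle\varphi|\rho|\varphi\rangle$, the maximum being over the fully product pure states $|\varphi\rangle=|a_1\rangle\otimes\dots\otimes|a_N\rangle$, and let $G(\rho)=-2\log\Lambda(\rho)$ be the geometric measure of entanglement (GM); $G(|\psi\rangle)$ means $G(|\psi\rangle\langle\psi|)$. A tensor product of $N$-partite states is again regarded as an $N$-partite state, the $j$-th party holding the $j$-th subsystems of all the factors. The GM of $\rho$ is called strong additive if $G(\rho\otimes\sigma)=G(\rho)+G(\sigma)$ for every $N$-partite state $\sigma$ (pure or mixed, of arbitrary finite local dimensions), and additive if $\lim_{n\to\infty}\frac1n G(\rho^{\otimes n})=G(\rho)$. Let $|\psi^*\rangle$ be the entrywise complex conjugate of $|\psi\rangle$ in the computational basis. (a) Let $|\psi\rangle$ be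 drawn according to the Haar (unitarily invariant) probability measure on pure states of $\bigotimes_{j=1}^N\mathbb C^{d_j}$. The probability that the GM of $|\psi\rangle$ is strong additive is smaller than $\exp\bigl[-\tfrac23\sqrt{d_T}+d_S\ln(59Nd_T)\bigr]$, and the probability that $$\log d_T-\log(d_S\ln d_T)-\log\tfrac92\;\le\; G(|\psi\rangle)\;<\;G(|\psi\rangle\otimes|\psi^*\rangle)\;\le\;\log d_T$$ is larger than $1-d_T^{-d_S}$. (b) Let $|\psi\rangle$ be drawn according to the Haar (orthogonally invariant) probability measure on pure states with real entries in the computational basis of $\bigotimes_{j=1}^N\mathbb C^{d_j}$. The probability that the GM of $|\psi\rangle$ is additive is smaller than $\exp\bigl[-\tfrac13\sqrt{d_T}+d_S\ln(59Nd_T)\bigr]$, and the probability that $$\log d_T-\log(d_S\ln d_T)-\log 9\;\le\; G(|\psi\rangle)\;<\;G(|\psi\rangle^{\otimes2})\;\le\;\log d_T$$ is larger than $1-d_T^{-d_S}$. -/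

import Mathlib

open MeasureTheory Filter Topology
open scoped ComplexOrder

namespace GeometricMeasure

noncomputable section

/-! ### Multipartite states

There are `N` parties.  The `j`-th local Hilbert space is `ℂ ^ κ j`, with computational basis
labelled by the finite type `κ j`; the joint space `⨂ j, ℂ ^ κ j` has the computational basis
labelled by the functions `i : (j : Fin N) → κ j`. -/

/-- Labels of the joint computational basis. -/
abbrev Label {N : ℕ} (κ : Fin N → Type) : Type := (j : Fin N) → κ j

/-- Operators on the joint space, as matrices in the computational basis. -/
abbrev Op {N : ℕ} (κ : Fin N → Type) : Type := Matrix (Label κ) (Label κ) ℂ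

/-- Density matrices. -/
structure IsState {ι : Type} [Fintype ι] (ρ : Matrix ι ι ℂ) : Prop where
  posSemidef : ρ.PosSemidef
  trace_eq_one : ρ.trace = 1

/-- The projector `|ψ⟩⟨ψ|`. -/
def proj {ι : Type} (ψ : ι → ℂ) : Matrix ι ι ℂ := Matrix.vecMulVec ψ (star ψ)

/-- The tensor product `ρ ⊗ σ` of two `N`-partite operators, seen as an `N`-partite operator: the
`j`-th party holds the `j`-th subsystems of both factors. -/
def tensor {N : ℕ} {κ κ' : Fin N → Type} (ρ : Op κ) (σ : Op κ') : Op (fun j => κ j × κ' j) :=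
  fun i i' => ρ (fun j => (i j).1) (fun j => (i' j).1) * σ (fun j => (i j).2) (fun j => (i' j).2)

/-- The `n`-fold tensor power `ρ^{⊗ n}`, seen as an `N`-partite operator: the `j`-th party holds
the `j`-th subsystems of all the copies. -/
def tensorPow {N : ℕ} {κ : Fin N → Type} (ρ : Op κ) (n : ℕ) : Op (fun j => Fin n → κ j) :=
  fun i i' => ∏ k : Fin n, ρ (fun j => i j k) (fun j => i' j k)

section GM

variable {N : ℕ} {κ : Fin N → Type} [∀ j, Fintype (κ j)]

/-- Tuples `(|a_1⟩, …, |a_N⟩)` of normalized local kets. -/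
abbrev LocalKets (κ : Fin N → Type) [∀ j, Fintype (κ j)] : Type :=
  (j : Fin N) → Metric.sphere (0 : EuclideanSpace ℂ (κ j)) 1

/-- The fully product ket `|a_1⟩ ⊗ ⋯ ⊗ |a_N⟩`. -/
def productKet (a : LocalKets κ) : Label κ → ℂ := fun i => ∏ j, (a j).1 (i j)

/-- The overlap `⟨φ|ρ|φ⟩`. -/
def overlap {ι : Type} [Fintype ι] (ρ : Matrix ι ι ℂ) (φ : ι → ℂ) : ℝ :=
  (star φ ⬝ᵥ Matrix.mulVec ρ φ).re

/-- `Λ²(ρ)`, the maximum of `⟨φ|ρ|φ⟩` over the fully product pure states `|φ⟩`. -/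
def lambdaSq (ρ : Op κ) : ℝ := ⨆ a : LocalKets κ, overlap ρ (productKet a)

/-- `Λ(ρ)`. -/
def lambda (ρ : Op κ) : ℝ := √(lambdaSq ρ)

/-- The geometric measure of entanglement `G(ρ) = -2 log₂ Λ(ρ)`. -/
def G (ρ : Op κ) : ℝ := -2 * Real.logb 2 (lambda ρ)

/-- The geometric measure of `ρ` is strong additive: `G(ρ ⊗ σ) = G(ρ) + G(σ)` for every
`N`-partite state `σ`, pure or mixed, with arbitrary local dimensions. -/
def IsStrongAdditive (ρ : Op κ) : Prop :=
  ∀ (e : Fin N → ℕ) (σ : Op (fun j => Fin (e j))), IsState σ → G (tensor ρ σ) = G ρ + G σ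

/-- The geometric measure of `ρ` is additive: the regularized measure
`G^∞(ρ) = lim (1 / n) G(ρ^{⊗ n})` equals `G(ρ)`. -/
def IsAdditive (ρ : Op κ) : Prop :=
  Tendsto (fun n : ℕ => (1 / (n : ℝ)) * G (tensorPow ρ n)) atTop (𝓝 (G ρ))

end GM


section Haar

open scoped Pointwise

/-- Normalized kets with amplitudes in `𝕜` (`ℂ` or `ℝ`) in the basis labelled by `ι`. -/
abbrev Ket (𝕜 ι : Type) [RCLike 𝕜] [Fintype ι] : Type :=
  Metric.sphere (0 : EuclideanSpace 𝕜 ι) 1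

/-- The Haar measure on normalized kets: the normalized surface measure of the unit sphere of
`𝕜 ^ ι`, which is invariant under the unitary (orthogonal, if `𝕜 = ℝ`) group. -/
def haarKet (𝕜 ι : Type) [RCLike 𝕜] [Fintype ι] : Measure (Ket 𝕜 ι) :=
  ((Measure.addHaar : Measure (EuclideanSpace 𝕜 ι)).toSphere Set.univ)⁻¹ •
    (Measure.addHaar : Measure (EuclideanSpace 𝕜 ι)).toSphere

instance (𝕜 ι : Type) [RCLike 𝕜] [Fintype ι] [Nonempty ι] : IsProbabilityMeasure (haarKet 𝕜 ι) := by
  refine ⟨?_⟩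
  have h : (Measure.addHaar : Measure (EuclideanSpace 𝕜 ι)).toSphere ≠ 0 :=
    Measure.toSphere_ne_zero _
  simp only [haarKet, Measure.smul_apply, smul_eq_mul]
  exact ENNReal.inv_mul_cancel (Measure.measure_univ_ne_zero.2 h) (measure_ne_top _ _)

/-- The amplitudes of a normalized complex ket. -/
def amp {ι : Type} [Fintype ι] (ψ : Ket ℂ ι) : ι → ℂ := fun i => ψ.1 i

/-- The amplitudes of a normalized real ket, as complex numbers. -/
def ampReal {ι : Type} [Fintype ι] (ψ : Ket ℝ ι) : ι → ℂ := fun i => (ψ.1 i : ℂ)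

/-- A linear isometry of `𝕜 ^ ι` onto itself, acting on normalized kets. -/
def rotate {𝕜 ι : Type} [RCLike 𝕜] [Fintype ι]
    (U : EuclideanSpace 𝕜 ι ≃ₗᵢ[𝕜] EuclideanSpace 𝕜 ι) (ψ : Ket 𝕜 ι) : Ket 𝕜 ι :=
  ⟨U ψ.1, by simp⟩

/-- The Haar measure on kets is invariant under the unitary (orthogonal) group. -/
theorem map_rotate_haar {𝕜 ι : Type} [RCLike 𝕜] [Fintype ι]
    (U : EuclideanSpace 𝕜 ι ≃ₗᵢ[𝕜] EuclideanSpace 𝕜 ι) :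
    (haarKet 𝕜 ι).map (rotate U) = haarKet 𝕜 ι := by
  have hm : Measurable (rotate U) :=
    (U.continuous.comp continuous_subtype_val |>.subtype_mk _).measurable
  set L : EuclideanSpace 𝕜 ι →ₗ[ℝ] EuclideanSpace 𝕜 ι :=
    (U.symm.toLinearEquiv.toLinearMap).restrictScalars ℝ with hL
  have hLU : ∀ x, L x = U.symm x := fun x => rfl
  set μ : Measure (EuclideanSpace 𝕜 ι) := Measure.addHaar with hμ
  have hdet : ENNReal.ofReal |LinearMap.det L| = 1 := by
    have h1 := μ.addHaar_image_linearMap L (Metric.ball 0 1)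
    have h2 : L '' Metric.ball 0 1 = Metric.ball 0 1 := by
      have h3 := U.symm.image_ball 0 1
      rw [map_zero] at h3
      exact h3
    rw [h2] at h1
    have h0 : μ (Metric.ball 0 1) ≠ 0 := (Metric.measure_ball_pos μ 0 one_pos).ne'
    have ht : μ (Metric.ball 0 1) ≠ ⊤ := measure_ball_lt_top.ne
    exact (ENNReal.mul_eq_right h0 ht).1 h1.symm
  ext s hs
  rw [Measure.map_apply hm hs]
  simp only [haarKet, Measure.smul_apply, smul_eq_mul]
  congr 1
  rw [μ.toSphere_apply' hs, μ.toSphere_apply' (hm hs)]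
  congr 1
  have : (Set.Ioo (0 : ℝ) 1 • (Subtype.val '' (rotate U ⁻¹' s)) : Set (EuclideanSpace 𝕜 ι)) =
      L '' (Set.Ioo (0 : ℝ) 1 • (Subtype.val '' s)) := by
    ext x
    simp only [Set.mem_smul, Set.mem_image, Set.mem_preimage]
    constructor
    · rintro ⟨r, hr, _, ⟨y, hy, rfl⟩, rfl⟩
      refine ⟨r • (U y.1), ⟨r, hr, _, ⟨_, hy, rfl⟩, rfl⟩, ?_⟩
      rw [map_smul, hLU, U.symm_apply_apply]
    · rintro ⟨_, ⟨r, hr, _, ⟨y, hy, rfl⟩, rfl⟩, rfl⟩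
      refine ⟨r, hr, _, ⟨rotate U.symm y, ?_, rfl⟩, ?_⟩
      · have : rotate U (rotate U.symm y) = y := Subtype.ext (U.apply_symm_apply _)
        rwa [this]
      · rw [map_smul, hLU]; rfl
  rw [this, μ.addHaar_image_linearMap, hdet, one_mul]

end Haar

end

end GeometricMeasure

open GeometricMeasure

/-! Two facts collide. Write D for the total dimension.

Upper bounds on G. If each party uses the unnormalized maximally entangled vector ∑ₓ |xx⟩, the
overlap with ψ ⊗ ψ* is ∑ |ψᵢ|² = 1, while the product vector has squared norm D. Hence G(ψ ⊗ ψ*) ≤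
log D. A real ψ is its own conjugate, so pairing copies gives G(ψ^{⊗2m}) ≤ m log D. Either form of
additivity therefore forces 2 G(ψ) ≤ log D, that is Λ²(ψ) ≥ D^{-1/2}.

Concentration. For one product ket the overlap with a Haar random ket has Gaussian tails
(`haarKet_cap_le`). Nets of the local spheres and a union bound make Λ² small with high probability
(`haarKet_lambdaSq_ge_le`). The threshold D^{-1/2} bounds the probability of additivity; the
threshold K dS ln dT / dT gives the lower bound on G. Complex and real kets differ only through the
real dimension of the sphere, 2D or D, which causes the factor 2 between the constants.

The strict inequality between G of one and of two factors needs its own argument. Tensoring with χ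
keeps Λ² from decreasing only if every estimate for an optimal product ket is an equality, and then
χ is a product ket (`one_le_lambdaSq_of_le_lambdaSq_tensorKet`). Product kets satisfy quadratic
relations among amplitudes and are Haar-null (`haarKet_one_le_lambdaSq_eq_zero`). -/

namespace GeometricMeasure

open scoped Pointwise ENNReal Function

/-! ### Nets on unit spheres -/

section NormedSpace

variable {E : Type*} [NormedAddCommGroup E] [NormedSpace ℝ E] [FiniteDimensional ℝ E]

/-- Volume comparison: the balls of radius ε/2 about the points are disjoint and lie in the ball of
radius 1 + ε/2 about the origin. -/
theorem card_le_of_separated_sphere {ε : ℝ} (hε : 0 < ε) (s : Finset E)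
    (hs : ∀ c ∈ s, ‖c‖ = 1) (h : ∀ c ∈ s, ∀ d ∈ s, c ≠ d → ε ≤ ‖c - d‖) :
    (s.card : ℝ) ≤ (1 + 2 / ε) ^ Module.finrank ℝ E := by
  borelize E
  let μ : Measure E := Measure.addHaar
  have hδ : 0 < ε / 2 := by positivity
  have hρ : 0 < 1 + ε / 2 := by positivity
  have D : Set.Pairwise (s : Set E) (Disjoint on fun c => Metric.ball (c : E) (ε / 2)) := by
    rintro c hc d hd hcd
    apply Metric.ball_disjoint_ball
    rw [dist_eq_norm, add_halves]
    exact h c hc d hd hcd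
  have A_subset : (⋃ c ∈ s, Metric.ball (c : E) (ε / 2)) ⊆ Metric.ball (0 : E) (1 + ε / 2) := by
    refine Set.iUnion₂_subset fun x hx => ?_
    apply Metric.ball_subset_ball'
    rw [dist_zero_right, hs x hx, add_comm]
  have I : (s.card : ℝ≥0∞) * ENNReal.ofReal ((ε / 2) ^ Module.finrank ℝ E) * μ (Metric.ball 0 1) ≤
      ENNReal.ofReal ((1 + ε / 2) ^ Module.finrank ℝ E) * μ (Metric.ball 0 1) := by
    calc
      _ = μ (⋃ c ∈ s, Metric.ball (c : E) (ε / 2)) := by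
        rw [measure_biUnion_finset D fun c _ => measurableSet_ball]
        simp only [μ.addHaar_ball_of_pos _ hδ, Finset.sum_const, nsmul_eq_mul, mul_assoc]
      _ ≤ μ (Metric.ball (0 : E) (1 + ε / 2)) := measure_mono A_subset
      _ = _ := by simp only [μ.addHaar_ball_of_pos _ hρ]
  have J := (ENNReal.mul_le_mul_iff_left
    (Metric.measure_ball_pos μ 0 zero_lt_one).ne' measure_ball_lt_top.ne).1 I
  have K := ENNReal.toReal_le_of_le_ofReal (pow_nonneg hρ.le _) J
  rw [ENNReal.toReal_mul, ENNReal.toReal_natCast, ENNReal.toReal_ofReal (by positivity)] at K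
  have e : 1 + 2 / ε = (1 + ε / 2) / (ε / 2) := by field_simp; ring
  rw [e, div_pow, le_div_iff₀ (by positivity)]
  exact K

/-- The unit sphere of an `m`-dimensional real normed space has an `ε`-net with at most
`(1 + 2 / ε) ^ m` elements. -/
theorem exists_net_sphere {ε : ℝ} (hε : 0 < ε) :
    ∃ T : Finset (Metric.sphere (0 : E) 1),
      (T.card : ℝ) ≤ (1 + 2 / ε) ^ Module.finrank ℝ E ∧ ∀ x : Metric.sphere (0 : E) 1, ∃ y ∈ T, ‖x.1 - y.1‖ ≤ ε := by
  classical
  let P : Finset (Metric.sphere (0 : E) 1) → Prop := fun T =>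
    ∀ c ∈ T, ∀ d ∈ T, c ≠ d → ε ≤ ‖c.1 - d.1‖
  have hcard : ∀ T, P T → (T.card : ℝ) ≤ (1 + 2 / ε) ^ Module.finrank ℝ E := by
    intro T hT
    have := card_le_of_separated_sphere hε (T.image Subtype.val) (by
      intro c hc
      obtain ⟨c, -, rfl⟩ := Finset.mem_image.1 hc
      simp) (by
      intro c hc d hd hcd
      obtain ⟨c, hc', rfl⟩ := Finset.mem_image.1 hc
      obtain ⟨d, hd', rfl⟩ := Finset.mem_image.1 hd
      exact hT c hc' d hd' fun h => hcd (by rw [h]))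
    rwa [Finset.card_image_of_injective _ Subtype.val_injective] at this
  have hbdd : BddAbove {n : ℕ | ∃ T, P T ∧ T.card = n} := by
    refine ⟨⌊(1 + 2 / ε) ^ Module.finrank ℝ E⌋₊, ?_⟩
    rintro _ ⟨T, hT, rfl⟩
    exact Nat.le_floor (hcard T hT)
  -- A separated set of largest cardinality is a net, since a point farther than ε from all its
  -- members could be added to it.
  obtain ⟨T, hT, hTn⟩ := Nat.sSup_mem (⟨0, ∅, by simp [P], rfl⟩ :
    {n : ℕ | ∃ T, P T ∧ T.card = n}.Nonempty) hbdd
  refine ⟨T, hcard T hT, fun x => ?_⟩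
  by_contra! hx
  have hxT : x ∉ T := fun h => by
    have := hx x h
    rw [sub_self, norm_zero] at this
    exact absurd this (not_lt.2 hε.le)
  have : P (insert x T) := by
    intro c hc d hd hcd
    rcases Finset.mem_insert.1 hc with hc' | hc' <;> rcases Finset.mem_insert.1 hd with hd' | hd'
    · exact absurd (hc'.trans hd'.symm) hcd
    · rw [hc']; exact (hx d hd').le
    · rw [hd', norm_sub_rev]; exact (hx c hc').le
    · exact hT c hc' d hd' hcd
  have h2 := le_csSup hbdd ⟨_, this, rfl⟩
  rw [← hTn, Finset.card_insert_of_notMem hxT] at h2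
  omega

end NormedSpace

/-! ### Haar measure on kets: spherical caps and null sets -/

section Haar

variable {𝕜 ι : Type} [RCLike 𝕜] [Fintype ι]

/-- Turns probabilities on the sphere into volume ratios: the cone over `S` against the unit ball.
-/
theorem haarKet_apply [Nonempty ι] {S : Set (Ket 𝕜 ι)} (hS : MeasurableSet S) :
    haarKet 𝕜 ι S = (Measure.addHaar (Metric.ball (0 : EuclideanSpace 𝕜 ι) 1))⁻¹ *
      Measure.addHaar (Set.Ioo (0 : ℝ) 1 • (Subtype.val '' S) : Set (EuclideanSpace 𝕜 ι)) := by
  have h0 : (Module.finrank ℝ (EuclideanSpace 𝕜 ι) : ℝ≥0∞) ≠ 0 := by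
    simpa using Module.finrank_pos.ne'
  rw [haarKet, Measure.smul_apply, smul_eq_mul, Measure.toSphere_apply' _ hS,
    Measure.toSphere_apply_univ, ENNReal.mul_inv (Or.inl h0) (Or.inl (ENNReal.natCast_ne_top _))]
  rw [mul_mul_mul_comm, mul_comm, mul_comm _⁻¹ (Module.finrank ℝ (EuclideanSpace 𝕜 ι) : ℝ≥0∞),
    ENNReal.mul_inv_cancel h0 (ENNReal.natCast_ne_top _), mul_one]

/-- A spherical sector of height `s` lies in a ball of radius `exp (-s ^ 2 / 2)`. -/
theorem sector_subset_closedBall {E : Type*} [NormedAddCommGroup E] [InnerProductSpace 𝕜 E]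
    {u : E} (hu : ‖u‖ ≤ 1) {s : ℝ} (hs : 0 < s) (hs1 : s ≤ 1) :
    ∃ c : E, ∀ y : E, ‖y‖ = 1 → s ≤ RCLike.re (inner 𝕜 u y) → ∀ r : ℝ, 0 ≤ r → r ≤ 1 →
      ‖((r : 𝕜) • y) - c‖ ≤ Real.exp (-s ^ 2 / 2) := by
  have key : ∀ (y : E) (r a : ℝ), ‖y‖ = 1 →
      ‖((r : 𝕜) • y) - (a : 𝕜) • u‖ ^ 2 =
        r ^ 2 - 2 * (r * a * RCLike.re (inner 𝕜 u y)) + a ^ 2 * ‖u‖ ^ 2 := by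
    intro y r a hy
    rw [norm_sub_sq (𝕜 := 𝕜), norm_smul, norm_smul, inner_smul_left, inner_smul_right, mul_pow,
      mul_pow, hy, RCLike.conj_ofReal, ← mul_assoc, ← RCLike.ofReal_mul, RCLike.re_ofReal_mul,
      ← inner_re_symm]
    simp
  have hexp : Real.exp (-s ^ 2 / 2) ^ 2 = Real.exp (-s ^ 2) := by
    rw [← Real.exp_nat_mul]; congr 1; push_cast; ring
  have hu2 : ‖u‖ ^ 2 ≤ 1 := pow_le_one₀ (norm_nonneg _) hu
  rcases le_total (2 * s ^ 2) 1 with h | h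
  -- With centre s u the squared distance is at most r² - 2rs² + s², convex in r, with end values s²
  -- and 1 - s². Here s² ≤ 1 - s² ≤ exp (-s²).
  · refine ⟨(s : 𝕜) • u, fun y hy hsy r hr0 hr1 => ?_⟩
    refine le_of_sq_le_sq ?_ (Real.exp_pos _).le
    rw [key y r s hy, hexp]
    have h1 := Real.add_one_le_exp (-s ^ 2)
    have h2 : r * s * s ≤ r * s * RCLike.re (inner 𝕜 u y) := by gcongr
    have h3 : s ^ 2 * ‖u‖ ^ 2 ≤ s ^ 2 * 1 := by gcongr
    nlinarith
  -- With centre u / (2s) the squared distance is at most r² - r + 1/(4s²) ≤ 1/(4s²).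
  · refine ⟨((1 / (2 * s) : ℝ) : 𝕜) • u, fun y hy hsy r hr0 hr1 => ?_⟩
    refine le_of_sq_le_sq ?_ (Real.exp_pos _).le
    rw [key y r _ hy, hexp]
    have h2 : r * (1 / (2 * s)) * s ≤ r * (1 / (2 * s)) * RCLike.re (inner 𝕜 u y) := by gcongr
    have h2' : r * (1 / (2 * s)) * s = r / 2 := by field_simp
    have h3 : (1 / (2 * s)) ^ 2 * ‖u‖ ^ 2 ≤ (1 / (2 * s)) ^ 2 * 1 := by gcongr
    have h4 : (1 / (2 * s)) ^ 2 ≤ Real.exp (-s ^ 2) := by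
      -- The chord of exp over [1/2, 1], with end values at most 2 and 3, gives exp (s²) ≤ 1 + 2s² ≤
      -- 4s².
      have hle : Real.exp (s ^ 2) ≤ 4 * s ^ 2 := by
        have hc := convexOn_exp.2 (Set.mem_univ (1 / 2 : ℝ)) (Set.mem_univ 1)
          (show 0 ≤ 2 * (1 - s ^ 2) by nlinarith) (show 0 ≤ 2 * s ^ 2 - 1 by linarith) (by ring)
        have e1 : Real.exp 1 ≤ 3 := by linarith [Real.exp_one_lt_d9]
        have e2 : Real.exp (1 / 2) ≤ 2 := by
          refine le_of_sq_le_sq ?_ two_pos.le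
          rw [← Real.exp_nat_mul]
          norm_num
          linarith
        simp only [smul_eq_mul] at hc
        have e3 : 2 * (1 - s ^ 2) * (1 / 2) + (2 * s ^ 2 - 1) * 1 = s ^ 2 := by ring
        rw [e3] at hc
        have hs2 : s ^ 2 ≤ 1 := pow_le_one₀ hs.le hs1
        nlinarith [mul_nonneg (sub_nonneg.2 hs2) (sub_nonneg.2 e2),
          mul_nonneg (sub_nonneg.2 h) (sub_nonneg.2 e1)]
      rw [Real.exp_neg, one_div, inv_pow]
      apply inv_anti₀ (Real.exp_pos _)
      linarith
    nlinarith

/-- Concentration of measure for spherical caps. -/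
theorem haarKet_cap_le [Nonempty ι] {u : EuclideanSpace 𝕜 ι} (hu : ‖u‖ ≤ 1) {s : ℝ} (hs : 0 < s) :
    (haarKet 𝕜 ι).real {ψ | s ≤ RCLike.re (inner 𝕜 u ψ.1)} ≤
      Real.exp (-(Module.finrank ℝ (EuclideanSpace 𝕜 ι) * s ^ 2 / 2)) := by
  rcases lt_or_ge 1 s with h1 | h1
  · have : {ψ : Ket 𝕜 ι | s ≤ RCLike.re (inner 𝕜 u ψ.1)} = ∅ := by
      ext ψ
      simp only [Set.mem_ofPred_eq, Set.mem_empty_iff_false, iff_false, not_le]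
      have h2 : ‖ψ.1‖ = 1 := by simp
      have h3 := (RCLike.re_le_norm _).trans (norm_inner_le_norm (𝕜 := 𝕜) u ψ.1)
      rw [h2, mul_one] at h3
      linarith
    rw [this, measureReal_empty]
    exact (Real.exp_pos _).le
  · have hm : MeasurableSet {ψ : Ket 𝕜 ι | s ≤ RCLike.re (inner 𝕜 u ψ.1)} := by
      apply IsClosed.measurableSet
      exact isClosed_le continuous_const (by fun_prop)
    obtain ⟨c, hc⟩ := sector_subset_closedBall (𝕜 := 𝕜) hu hs h1
    have hsub : (Set.Ioo (0 : ℝ) 1 • (Subtype.val '' {ψ : Ket 𝕜 ι | s ≤ RCLike.re (inner 𝕜 u ψ.1)}) :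
        Set (EuclideanSpace 𝕜 ι)) ⊆ Metric.closedBall c (Real.exp (-s ^ 2 / 2)) := by
      rintro _ ⟨r, hr, _, ⟨ψ, hψ, rfl⟩, rfl⟩
      rw [Metric.mem_closedBall, dist_eq_norm]
      have := hc ψ.1 (by simp) hψ r hr.1.le hr.2.le
      rwa [← RCLike.real_smul_eq_coe_smul] at this
    have h0 : Measure.addHaar (Metric.ball (0 : EuclideanSpace 𝕜 ι) 1) ≠ 0 :=
      (Metric.measure_ball_pos _ 0 one_pos).ne'
    have ht : Measure.addHaar (Metric.ball (0 : EuclideanSpace 𝕜 ι) 1) ≠ ⊤ :=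
      measure_ball_lt_top.ne
    refine ENNReal.toReal_le_of_le_ofReal (Real.exp_pos _).le ?_
    rw [haarKet_apply hm]
    refine (mul_le_mul_right (measure_mono hsub) _).trans ?_
    rw [Measure.addHaar_closedBall _ _ (Real.exp_pos _).le, mul_comm, mul_assoc,
      ENNReal.mul_inv_cancel h0 ht, mul_one, ← Real.exp_nat_mul]
    apply le_of_eq
    congr 2
    ring

/-- The exceptional set is stable under positive scaling, so the cone over its trace on the sphere
stays inside it and has volume zero. -/
theorem ae_haarKet_of_homogeneous [Nonempty ι] {p : EuclideanSpace 𝕜 ι → Prop}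
    (hm : MeasurableSet {x | p x}) (hp : ∀ᵐ x ∂(Measure.addHaar : Measure (EuclideanSpace 𝕜 ι)), p x)
    (hhom : ∀ (r : ℝ) x, 0 < r → p (r • x) → p x) : ∀ᵐ ψ ∂(haarKet 𝕜 ι), p ψ.1 := by
  rw [ae_iff]
  have hm' : MeasurableSet {ψ : Ket 𝕜 ι | ¬ p ψ.1} := measurable_subtype_coe hm.compl
  rw [haarKet_apply hm', mul_eq_zero]
  right
  refine measure_mono_null ?_ hp
  rintro _ ⟨r, hr, _, ⟨ψ, hψ, rfl⟩, rfl⟩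
  exact fun h => hψ (hhom r _ hr.1 h)

theorem ae_coord_ne_zero [DecidableEq ι] (b : ι) :
    ∀ᵐ x ∂(Measure.addHaar : Measure (EuclideanSpace 𝕜 ι)), x b ≠ 0 := by
  have hm : MeasurableSet {x : EuclideanSpace 𝕜 ι | x b ≠ 0} :=
    (isOpen_ne_fun (by fun_prop) continuous_const).measurableSet
  refine ae_mem_of_ae_add_linearMap_mem
    (LinearMap.toSpanSingleton 𝕜 (EuclideanSpace 𝕜 ι) (EuclideanSpace.single b 1))
    (Measure.addHaar : Measure 𝕜) _ hm fun y => ?_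
  have := Measure.ae_ne (Measure.addHaar : Measure 𝕜) (-y b)
  filter_upwards [this] with t ht h
  apply ht
  simp at h
  linear_combination h

/-- Along the direction of the coordinate `a` the equation is affine with slope x b, which is almost
surely nonzero; it then has a single solution on each line. -/
theorem ae_mul_ne_mul [DecidableEq ι] {a b c e : ι} (hab : a ≠ b) (hac : a ≠ c) (hae : a ≠ e) :
    ∀ᵐ x ∂(Measure.addHaar : Measure (EuclideanSpace 𝕜 ι)), x a * x b ≠ x c * x e := by
  have hm : MeasurableSet {x : EuclideanSpace 𝕜 ι | x a * x b ≠ x c * x e} :=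
    (isOpen_ne_fun (by fun_prop) (by fun_prop)).measurableSet
  refine (ae_ae_add_linearMap_mem_iff
    (LinearMap.toSpanSingleton 𝕜 (EuclideanSpace 𝕜 ι) (EuclideanSpace.single a 1))
    (Measure.addHaar : Measure 𝕜) _ hm).1 ?_
  filter_upwards [ae_coord_ne_zero b] with y hy
  have := Measure.ae_ne (Measure.addHaar : Measure 𝕜) (y c * y e / y b - y a)
  filter_upwards [this] with t ht h
  apply ht
  simp [hab.symm, hac.symm, hae.symm] at h
  field_simp
  linear_combination h

theorem ae_haarKet_mul_ne_mul [Nonempty ι] [DecidableEq ι] {a b c e : ι} (hab : a ≠ b)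
    (hac : a ≠ c) (hae : a ≠ e) : ∀ᵐ ψ ∂(haarKet 𝕜 ι), ψ.1 a * ψ.1 b ≠ ψ.1 c * ψ.1 e := by
  refine ae_haarKet_of_homogeneous (p := fun x => x a * x b ≠ x c * x e)
    (isOpen_ne_fun (by fun_prop) (by fun_prop)).measurableSet (ae_mul_ne_mul hab hac hae) ?_
  intro r x _ h h'
  apply h
  simp only [PiLp.smul_apply, RCLike.real_smul_eq_coe_mul]
  linear_combination (r : 𝕜) ^ 2 * h'

end Haar

/-! ### Overlaps with product vectors and their maximum -/

section Overlap

variable {N : ℕ} {κ : Fin N → Type} [∀ j, Fintype (κ j)]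

/-- The inner product `⟨ψ|x_1 ⊗ ⋯ ⊗ x_N⟩`, as a multilinear map of the local vectors. -/
noncomputable def prodInner (ψ : Label κ → ℂ) :
    MultilinearMap ℂ (fun j => EuclideanSpace ℂ (κ j)) ℂ :=
  ∑ i : Label κ, star (ψ i) • (MultilinearMap.mkPiAlgebra ℂ (Fin N) ℂ).compLinearMap
    fun j => (EuclideanSpace.proj (i j) : EuclideanSpace ℂ (κ j) →L[ℂ] ℂ).toLinearMap

theorem prodInner_apply (ψ : Label κ → ℂ) (x : (j : Fin N) → EuclideanSpace ℂ (κ j)) :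
    prodInner ψ x = ∑ i, star (ψ i) * ∏ j, x j (i j) := by
  simp [prodInner]

/-- The product vector `x_1 ⊗ ⋯ ⊗ x_N`. -/
noncomputable def prodVec (x : (j : Fin N) → EuclideanSpace ℂ (κ j)) :
    EuclideanSpace ℂ (Label κ) := WithLp.toLp 2 fun i => ∏ j, x j (i j)

theorem prodInner_eq_inner (ψ : Label κ → ℂ) (x : (j : Fin N) → EuclideanSpace ℂ (κ j)) :
    prodInner ψ x = inner ℂ (WithLp.toLp 2 ψ) (prodVec x) := by
  rw [prodInner_apply, PiLp.inner_apply]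
  simp [prodVec, mul_comm]

theorem inner_prodVec (x y : (j : Fin N) → EuclideanSpace ℂ (κ j)) :
    inner ℂ (prodVec x) (prodVec y) = ∏ j, inner ℂ (x j) (y j) := by
  simp only [PiLp.inner_apply, prodVec]
  rw [Finset.prod_univ_sum, Fintype.piFinset_univ]
  refine Finset.sum_congr rfl fun i _ => ?_
  simp [Finset.prod_mul_distrib]

theorem norm_prodVec (x : (j : Fin N) → EuclideanSpace ℂ (κ j)) :
    ‖prodVec x‖ = ∏ j, ‖x j‖ := by
  have h := inner_prodVec x x
  simp only [inner_self_eq_norm_sq_to_K] at h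
  have h2 : ‖prodVec x‖ ^ 2 = (∏ j, ‖x j‖) ^ 2 := by
    rw [← Finset.prod_pow]
    exact_mod_cast h
  exact (pow_left_inj₀ (norm_nonneg _) (by positivity) two_ne_zero).1 h2

theorem norm_prodInner_le (ψ : Label κ → ℂ) (x : (j : Fin N) → EuclideanSpace ℂ (κ j)) :
    ‖prodInner ψ x‖ ≤ ‖(WithLp.toLp 2 ψ : EuclideanSpace ℂ (Label κ))‖ * ∏ j, ‖x j‖ := by
  rw [prodInner_eq_inner, ← norm_prodVec]
  exact norm_inner_le_norm _ _

theorem overlap_proj_productKet (ψ : Label κ → ℂ) (a : LocalKets κ) :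
    overlap (proj ψ) (productKet a) = ‖prodInner ψ fun j => (a j).1‖ ^ 2 := by
  have h1 : star (productKet a) ⬝ᵥ Matrix.mulVec (proj ψ) (productKet a) =
      star (prodInner ψ fun j => (a j).1) * prodInner ψ fun j => (a j).1 := by
    have h2 : star ψ ⬝ᵥ productKet a = prodInner ψ fun j => (a j).1 := by
      rw [prodInner_apply]; rfl
    rw [← h2, proj, Matrix.vecMulVec_mulVec, Matrix.star_dotProduct ψ, star_star]
    simp [dotProduct_smul, mul_comm]
  rw [overlap, h1, Complex.star_def, ← Complex.normSq_eq_conj_mul_self, Complex.normSq_eq_norm_sq]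
  exact Complex.ofReal_re _


section Maximum

theorem nonempty_localKets [∀ j, Nonempty (κ j)] : Nonempty (LocalKets κ) := by
  classical
  exact ⟨fun j => ⟨EuclideanSpace.single (Classical.arbitrary (κ j)) 1, by simp⟩⟩

theorem exists_lambdaSq_eq [∀ j, Nonempty (κ j)] (ψ : Label κ → ℂ) :
    ∃ a : LocalKets κ, lambdaSq (proj ψ) = ‖prodInner ψ fun j => (a j).1‖ ^ 2 ∧
      ∀ b : LocalKets κ, ‖prodInner ψ fun j => (b j).1‖ ^ 2 ≤ lambdaSq (proj ψ) := by
  have := nonempty_localKets (κ := κ)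
  have hc : Continuous fun a : LocalKets κ => ‖prodInner ψ fun j => (a j).1‖ ^ 2 := by
    simp only [prodInner_apply]
    fun_prop
  have hcomp : CompactSpace (LocalKets κ) := inferInstance
  obtain ⟨a, -, ha⟩ := isCompact_univ.exists_isMaxOn Set.univ_nonempty hc.continuousOn
  have hmax : ∀ b : LocalKets κ, ‖prodInner ψ fun j => (b j).1‖ ^ 2 ≤
      ‖prodInner ψ fun j => (a j).1‖ ^ 2 := fun b => ha (Set.mem_univ b)
  have hl : lambdaSq (proj ψ) = ‖prodInner ψ fun j => (a j).1‖ ^ 2 := by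
    simp only [lambdaSq, overlap_proj_productKet]
    apply le_antisymm
    · exact ciSup_le hmax
    · exact le_ciSup (f := fun b : LocalKets κ => ‖prodInner ψ fun j => (b j).1‖ ^ 2)
        ⟨_, Set.forall_mem_range.2 hmax⟩ a
  exact ⟨a, hl, fun b => hl ▸ hmax b⟩

variable [∀ j, Nonempty (κ j)]

theorem lambdaSq_proj_nonneg (ψ : Label κ → ℂ) : 0 ≤ lambdaSq (proj ψ) := by
  obtain ⟨a, ha, -⟩ := exists_lambdaSq_eq ψ
  rw [ha]; positivity

/-- Homogeneous form of the maximality of Λ², allowing unnormalized and zero local vectors; every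
later witness is fed in through it. -/
theorem norm_prodInner_sq_le (ψ : Label κ → ℂ) (x : (j : Fin N) → EuclideanSpace ℂ (κ j)) :
    ‖prodInner ψ x‖ ^ 2 ≤ lambdaSq (proj ψ) * ∏ j, ‖x j‖ ^ 2 := by
  by_cases h : ∃ j, x j = 0
  · obtain ⟨j, hj⟩ := h
    rw [(prodInner ψ).map_coord_zero j hj]
    simpa using mul_nonneg (lambdaSq_proj_nonneg ψ) (by positivity)
  · push Not at h
    obtain ⟨a, -, ha⟩ := exists_lambdaSq_eq ψ
    have hn : ∀ j, ‖x j‖ ≠ 0 := fun j => norm_ne_zero_iff.2 (h j)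
    let b : LocalKets κ := fun j => ⟨((‖x j‖ : ℂ)⁻¹) • x j, by
      simp [norm_smul, hn j]⟩
    have hb := ha b
    have e : (prodInner ψ fun j => (b j).1) = (∏ j, (‖x j‖ : ℂ)⁻¹) * prodInner ψ x := by
      rw [← smul_eq_mul, ← MultilinearMap.map_smul_univ]
    rw [e, norm_mul, mul_pow] at hb
    have e2 : ‖∏ j, (‖x j‖ : ℂ)⁻¹‖ ^ 2 = (∏ j, ‖x j‖ ^ 2)⁻¹ := by
      rw [norm_prod, ← Finset.prod_pow, ← Finset.prod_inv_distrib]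
      exact Finset.prod_congr rfl fun j _ => by simp
    rw [e2] at hb
    have hp : 0 < ∏ j, ‖x j‖ ^ 2 := Finset.prod_pos fun j _ => by
      have := hn j
      positivity
    rwa [inv_mul_le_iff₀ hp, mul_comm] at hb

theorem lambdaSq_le_iff {ψ : Label κ → ℂ} {t : ℝ} :
    lambdaSq (proj ψ) ≤ t ↔ ∀ a : LocalKets κ, ‖prodInner ψ fun j => (a j).1‖ ^ 2 ≤ t := by
  obtain ⟨a, h1, h2⟩ := exists_lambdaSq_eq ψ
  exact ⟨fun h b => (h2 b).trans h, fun h => h1 ▸ h a⟩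

/-- The maximal overlap is attained by a product ket with real nonnegative amplitude. -/
theorem exists_re_prodInner_eq (hN : 0 < N) (ψ : Label κ → ℂ) :
    ∃ a : LocalKets κ, (prodInner ψ fun j => (a j).1).re = √(lambdaSq (proj ψ)) := by
  obtain ⟨a, ha, -⟩ := exists_lambdaSq_eq ψ
  set z := prodInner ψ fun j => (a j).1 with hz
  rw [ha, Real.sqrt_sq (norm_nonneg _)]
  obtain ⟨c, hc, hcz⟩ : ∃ c : ℂ, ‖c‖ = 1 ∧ c * z = ‖z‖ := by
    by_cases h : z = 0
    · exact ⟨1, by simp [h]⟩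
    · have h' : (‖z‖ : ℂ) ≠ 0 := by simpa using h
      refine ⟨star z / ‖z‖, by simp [h], ?_⟩
      rw [Complex.star_def, div_mul_eq_mul_div, Complex.conj_mul', sq, mul_div_assoc,
        div_self h', mul_one]
  let j₀ : Fin N := ⟨0, hN⟩
  have hx : (Function.update (fun j => (a j).1) j₀ (c • (a j₀).1)) =
      fun j => ((Function.update a j₀ ⟨c • (a j₀).1, by simp [norm_smul, hc]⟩ : LocalKets κ) j).1 := by
    funext j
    by_cases hj : j = j₀
    · subst hj; simp
    · simp [hj]
  refine ⟨Function.update a j₀ ⟨c • (a j₀).1, by simp [norm_smul, hc]⟩, ?_⟩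
  rw [← hx, MultilinearMap.map_update_smul, Function.update_eq_self, smul_eq_mul, ← hz, hcz]
  exact Complex.ofReal_re _

theorem lambdaSq_pos {ψ : Label κ → ℂ} (h : ψ ≠ 0) : 0 < lambdaSq (proj ψ) := by
  classical
  obtain ⟨i, hi⟩ := Function.ne_iff.1 h
  have := norm_prodInner_sq_le ψ fun j => EuclideanSpace.single (i j) 1
  rw [prodInner_apply, Finset.sum_eq_single i] at this
  · simp at this
    exact (pow_pos (norm_pos_iff.2 hi) 2).trans_le this
  · intro k _ hk
    obtain ⟨j, hj⟩ := Function.ne_iff.1 hk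
    rw [Finset.prod_eq_zero (Finset.mem_univ j) (by simp [hj]), mul_zero]
  · simp

theorem lambdaSq_star_le (ψ : Label κ → ℂ) :
    lambdaSq (proj (star ψ)) ≤ lambdaSq (proj ψ) := by
  refine lambdaSq_le_iff.2 fun a => ?_
  have := norm_prodInner_sq_le ψ fun j => WithLp.toLp 2 (star (WithLp.ofLp (a j).1))
  have e : (prodInner ψ fun j => WithLp.toLp 2 (star (WithLp.ofLp (a j).1))) =
      star (prodInner (star ψ) fun j => (a j).1) := by
    simp [prodInner_apply]
  rw [e, norm_star] at this
  refine this.trans_eq ?_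
  have h1 : ∀ j, ‖(WithLp.toLp 2 (star (WithLp.ofLp (a j).1)) : EuclideanSpace ℂ (κ j))‖ = 1 := by
    intro j
    have h2 : ‖(a j).1‖ = 1 := by simp
    rw [EuclideanSpace.norm_eq] at h2 ⊢
    simpa using h2
  simp [h1]

theorem lambdaSq_star (ψ : Label κ → ℂ) :
    lambdaSq (proj (star ψ)) = lambdaSq (proj ψ) := by
  refine le_antisymm (lambdaSq_star_le ψ) ?_
  simpa using lambdaSq_star_le (star ψ)

/-- A ket with `Λ² ≥ 1` is a product ket, so its amplitudes satisfy the rank-one relations. -/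
theorem mul_eq_mul_of_one_le_lambdaSq {ψ : Label κ → ℂ}
    (h : ‖(WithLp.toLp 2 ψ : EuclideanSpace ℂ (Label κ))‖ = 1) (h1 : 1 ≤ lambdaSq (proj ψ))
    (z : Label κ) {j l : Fin N} (hjl : j ≠ l) (m : κ j) (n : κ l) :
    ψ z * ψ (Function.update (Function.update z j m) l n) =
      ψ (Function.update z j m) * ψ (Function.update z l n) := by
  obtain ⟨a, ha, -⟩ := exists_lambdaSq_eq ψ
  have hn : ‖prodVec fun j => (a j).1‖ = 1 := by simp [norm_prodVec]
  have hle := norm_prodInner_le ψ fun j => (a j).1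
  -- Λ² ≥ 1 forces equality in Cauchy–Schwarz, so ψ is proportional to the optimal product vector.
  have heq : ‖inner ℂ (WithLp.toLp 2 ψ) (prodVec fun j => (a j).1)‖ =
      ‖(WithLp.toLp 2 ψ : EuclideanSpace ℂ (Label κ))‖ * ‖prodVec fun j => (a j).1‖ := by
    rw [← prodInner_eq_inner, h, hn]
    simp [h] at hle
    rw [ha] at h1
    nlinarith [norm_nonneg (prodInner ψ fun j => (a j).1)]
  rw [norm_inner_eq_norm_iff (by rw [← norm_ne_zero_iff, h]; exact one_ne_zero)
    (by rw [← norm_ne_zero_iff, hn]; exact one_ne_zero)] at heq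
  obtain ⟨r, hr, hr2⟩ := heq
  have hψ : ∀ i, ∏ k, (a k).1 (i k) = r * ψ i := fun i => by
    have := congrArg (fun v : EuclideanSpace ℂ (Label κ) => v i) hr2
    simpa [prodVec] using this
  apply mul_left_cancel₀ (mul_ne_zero hr hr)
  rw [mul_mul_mul_comm, mul_mul_mul_comm r r (ψ (Function.update z j m)), ← hψ, ← hψ, ← hψ, ← hψ,
    ← Finset.prod_mul_distrib, ← Finset.prod_mul_distrib]
  refine Finset.prod_congr rfl fun k _ => ?_
  by_cases hk : k = j
  · subst hk; simp [hjl, mul_comm]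
  · by_cases hk2 : k = l
    · subst hk2; simp [hjl.symm]
    · simp [hk, hk2]

end Maximum

end Overlap
-- Tensoring with a non-product ket lowers Λ²
section Tensor

variable {N : ℕ} {κ κ' : Fin N → Type}

/-- The tensor product of two kets. -/
def tensorKet (ψ : Label κ → ℂ) (χ : Label κ' → ℂ) : Label (fun j => κ j × κ' j) → ℂ :=
  fun i => ψ (fun j => (i j).1) * χ (fun j => (i j).2)

theorem tensor_proj (ψ : Label κ → ℂ) (χ : Label κ' → ℂ) :
    tensor (proj ψ) (proj χ) = proj (tensorKet ψ χ) := by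
  ext i i'
  simp [tensor, proj, tensorKet, Matrix.vecMulVec_apply]
  ring

/-- The labels of a tensor product of two multipartite systems. -/
def labelProdEquiv (κ κ' : Fin N → Type) :
    Label (fun j => κ j × κ' j) ≃ Label κ × Label κ' where
  toFun i := (fun j => (i j).1, fun j => (i j).2)
  invFun p := fun j => (p.1 j, p.2 j)
  left_inv _ := rfl
  right_inv _ := rfl

variable [∀ j, Fintype (κ j)] [∀ j, Fintype (κ' j)]

theorem sum_label_prod {M : Type*} [AddCommMonoid M] (f : Label κ → Label κ' → M) :
    ∑ i : Label (fun j => κ j × κ' j), f (fun j => (i j).1) (fun j => (i j).2) =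
      ∑ i', ∑ i, f i i' := by
  rw [Finset.sum_comm, ← Fintype.sum_prod_type']
  exact (labelProdEquiv κ κ').sum_comp fun p => f p.1 p.2

/-- With the other parties fixed, the overlap is a linear functional of the j-th vector. At its
Riesz vector v both the overlap and ‖v‖² equal the sum S, so S² ≤ Λ² S. -/
theorem sum_norm_prodInner_update_sq_le [∀ j, Nonempty (κ j)] (ψ : Label κ → ℂ)
    (x : (j : Fin N) → EuclideanSpace ℂ (κ j)) (hx : ∀ j, ‖x j‖ = 1) (j : Fin N)
    (β : OrthonormalBasis (κ j) ℂ (EuclideanSpace ℂ (κ j))) :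
    ∑ m, ‖prodInner ψ (Function.update x j (β m))‖ ^ 2 ≤ lambdaSq (proj ψ) := by
  set S := ∑ m, ‖prodInner ψ (Function.update x j (β m))‖ ^ 2 with hS
  have hS0 : 0 ≤ S := by positivity
  let v : EuclideanSpace ℂ (κ j) := ∑ m, star (prodInner ψ (Function.update x j (β m))) • β m
  have hv : ‖v‖ ^ 2 = S := by
    rw [← β.sum_sq_norm_inner_right v]
    refine Finset.sum_congr rfl fun m _ => ?_
    rw [β.orthonormal.inner_right_fintype, norm_star]
  have hov : prodInner ψ (Function.update x j v) = (S : ℂ) := by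
    rw [MultilinearMap.map_update_sum, hS, Complex.ofReal_sum]
    refine Finset.sum_congr rfl fun m _ => ?_
    rw [MultilinearMap.map_update_smul, smul_eq_mul, Complex.star_def, Complex.conj_mul']
    push_cast; rfl
  have hle := norm_prodInner_sq_le ψ (Function.update x j v)
  have hprod : ∏ l, ‖Function.update x j v l‖ ^ 2 = S := by
    rw [Finset.prod_eq_single j, Function.update_self, hv]
    · intro l _ hl
      rw [Function.update_of_ne hl, hx, one_pow]
    · simp
  rw [hov, hprod, Complex.norm_real, Real.norm_of_nonneg hS0] at hle
  rcases hS0.eq_or_lt with h0 | h0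
  · rw [← h0]; exact lambdaSq_proj_nonneg ψ
  · nlinarith

theorem exists_orthonormalBasis_apply_eq {ι : Type} [Fintype ι] (b : EuclideanSpace ℂ ι)
    (hb : ‖b‖ = 1) (o : ι) :
    ∃ β : OrthonormalBasis ι ℂ (EuclideanSpace ℂ ι), β o = b := by
  obtain ⟨β, hβ⟩ := Orthonormal.exists_orthonormalBasis_extension_of_card_eq (𝕜 := ℂ)
    (E := EuclideanSpace ℂ ι) (ι := ι) (by simp) (v := fun _ => b) (s := {o}) (by
      constructor
      · intro i; exact hb
      · intro i k hik
        exact absurd (Subsingleton.elim i k) hik)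
  exact ⟨β, hβ o rfl⟩

/-- The product of local orthonormal bases. -/
noncomputable def prodBasis [∀ j, DecidableEq (κ j)]
    (β : (j : Fin N) → OrthonormalBasis (κ j) ℂ (EuclideanSpace ℂ (κ j))) :
    OrthonormalBasis (Label κ) ℂ (EuclideanSpace ℂ (Label κ)) := by
  have ho : Orthonormal ℂ fun k : Label κ => prodVec fun j => β j (k j) := by
    rw [orthonormal_iff_ite]
    intro k l
    rw [inner_prodVec]
    simp only [OrthonormalBasis.inner_eq_ite]
    by_cases h : k = l
    · simp [h]
    · obtain ⟨j, hj⟩ := Function.ne_iff.1 h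
      rw [if_neg h, Finset.prod_eq_zero (Finset.mem_univ j) (if_neg hj)]
  exact OrthonormalBasis.mk ho
    (ho.linearIndependent.span_eq_top_of_card_eq_finrank' (by simp)).ge

theorem prodBasis_apply [∀ j, DecidableEq (κ j)]
    (β : (j : Fin N) → OrthonormalBasis (κ j) ℂ (EuclideanSpace ℂ (κ j))) (k : Label κ) :
    prodBasis β k = prodVec fun j => β j (k j) := by
  simp [prodBasis]

/-- If tensoring with `χ` does not decrease `Λ²`, then `χ` is a product ket. -/
theorem one_le_lambdaSq_of_le_lambdaSq_tensorKet [∀ j, Nonempty (κ j)] [∀ j, Nonempty (κ' j)]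
    {ψ : Label κ → ℂ} {χ : Label κ' → ℂ} (hψ : ψ ≠ 0)
    (hχ : ‖(WithLp.toLp 2 χ : EuclideanSpace ℂ (Label κ'))‖ = 1)
    (h : lambdaSq (proj ψ) ≤ lambdaSq (proj (tensorKet ψ χ))) : 1 ≤ lambdaSq (proj χ) := by
  classical
  set lam := lambdaSq (proj ψ) with hlam
  have hlam0 : 0 < lam := lambdaSq_pos hψ
  obtain ⟨a, ha, -⟩ := exists_lambdaSq_eq (tensorKet ψ χ)
  obtain ⟨b, hb, -⟩ := exists_lambdaSq_eq χ
  have o : Label κ' := fun j => Classical.arbitrary _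
  -- Each local basis contains the optimal vector b j for χ, at position o j.
  have hβ := fun j => exists_orthonormalBasis_apply_eq (b j).1 (by simp) (o j)
  choose β hβ using hβ
  -- Partial inner products of a j with the basis vectors; the weights q j m = ‖u j m‖² form a
  -- probability distribution for each party.
  let u : (j : Fin N) → κ' j → EuclideanSpace ℂ (κ j) := fun j m =>
    WithLp.toLp 2 fun x => ∑ y, star (β j m y) * (a j).1 (x, y)
  let q : (j : Fin N) → κ' j → ℝ := fun j m => ‖u j m‖ ^ 2
  have hq : ∀ j, ∑ m, q j m = 1 := by
    intro j
    have h1 : ‖(a j).1‖ ^ 2 = 1 := by simp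
    rw [EuclideanSpace.norm_sq_eq, Fintype.sum_prod_type] at h1
    rw [← h1]
    simp only [q, EuclideanSpace.norm_sq_eq]
    rw [Finset.sum_comm]
    refine Finset.sum_congr rfl fun x _ => ?_
    rw [← EuclideanSpace.norm_sq_eq (WithLp.toLp 2 fun y => (a j).1 (x, y)),
      ← (β j).sum_sq_norm_inner_right]
    refine Finset.sum_congr rfl fun m _ => ?_
    rw [PiLp.inner_apply]
    simp [u, mul_comm]
  -- Contracting the optimal product ket with ψ leaves w on the second system. Its coordinates in
  -- the product basis are overlaps of ψ with product vectors, whence ‖w‖² ≤ Λ²(ψ).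
  let w : EuclideanSpace ℂ (Label κ') :=
    WithLp.toLp 2 fun i' => ∑ i, star (ψ i) * ∏ j, (a j).1 (i j, i' j)
  have hw : (prodInner (tensorKet ψ χ) fun j => (a j).1) = inner ℂ (WithLp.toLp 2 χ) w := by
    rw [prodInner_apply, PiLp.inner_apply]
    have := sum_label_prod fun (i : Label κ) (i' : Label κ') =>
      star (χ i') * (star (ψ i) * ∏ j, (a j).1 (i j, i' j))
    simp only [← Finset.mul_sum] at this
    refine Eq.trans (Finset.sum_congr rfl fun i _ => ?_) (this.trans ?_)
    · simp [tensorKet]; ring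
    · refine Finset.sum_congr rfl fun i' _ => ?_
      simp [w, mul_comm]
  have hBw : ∀ k, inner ℂ (prodBasis β k) w = prodInner ψ fun j => u j (k j) := by
    intro k
    rw [prodBasis_apply, prodInner_apply, PiLp.inner_apply]
    simp only [w, u, prodVec, Finset.prod_univ_sum, Fintype.piFinset_univ, Finset.mul_sum]
    simp only [RCLike.inner_apply, Finset.sum_mul]
    rw [Finset.sum_comm]
    refine Finset.sum_congr rfl fun i _ => Finset.sum_congr rfl fun i' _ => ?_
    simp [Finset.prod_mul_distrib]
    ring
  have hterm : ∀ k, ‖inner ℂ (prodBasis β k) w‖ ^ 2 ≤ lam * ∏ j, q j (k j) := fun k => by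
    rw [hBw]; exact norm_prodInner_sq_le _ _
  have hsum : ∑ k : Label κ', lam * ∏ j, q j (k j) = lam := by
    rw [← Finset.mul_sum, ← Fintype.piFinset_univ, ← Finset.prod_univ_sum]
    simp [hq]
  have hwle : ‖w‖ ^ 2 ≤ lam := by
    rw [← (prodBasis β).sum_sq_norm_inner_right w, ← hsum]
    exact Finset.sum_le_sum fun k _ => hterm k
  have hcs : ‖inner ℂ (WithLp.toLp 2 χ) w‖ ≤ ‖w‖ := by
    have := norm_inner_le_norm (𝕜 := ℂ) (WithLp.toLp 2 χ) w
    rwa [hχ, one_mul] at this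
  rw [ha, hw] at h
  -- By hypothesis all the bounds are now equalities: w is a multiple of χ, and the squared
  -- coordinates of χ in the product basis are exactly the products of the weights.
  have hinner : ‖inner ℂ (WithLp.toLp 2 χ) w‖ = ‖w‖ := by
    refine hcs.antisymm (le_of_sq_le_sq (hwle.trans h) (norm_nonneg _))
  have hwlam : ‖w‖ ^ 2 = lam := hwle.antisymm (hinner ▸ h)
  have hw0 : w ≠ 0 := by
    intro h0
    rw [h0, norm_zero, zero_pow two_ne_zero] at hwlam
    exact hlam0.ne hwlam
  have hχ0 : (WithLp.toLp 2 χ : EuclideanSpace ℂ (Label κ')) ≠ 0 := by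
    rw [← norm_ne_zero_iff, hχ]; exact one_ne_zero
  obtain ⟨r, hr, hwr⟩ := (norm_inner_eq_norm_iff hχ0 hw0).1 (by rw [hinner, hχ, one_mul])
  have hr2 : ‖r‖ ^ 2 = lam := by
    rw [← hwlam, hwr, norm_smul, hχ, mul_one]
  have hterm_eq : ∀ k, ‖inner ℂ (prodBasis β k) w‖ ^ 2 = lam * ∏ j, q j (k j) := by
    have := (Finset.sum_eq_sum_iff_of_le fun k (_ : k ∈ Finset.univ) => hterm k).1 (by
      rw [hsum, (prodBasis β).sum_sq_norm_inner_right, hwlam])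
    exact fun k => this k (Finset.mem_univ k)
  have hχq : ∀ k : Label κ', ‖prodInner χ fun j => β j (k j)‖ ^ 2 = ∏ j, q j (k j) := by
    intro k
    have := hterm_eq k
    rw [hwr, inner_smul_right, norm_mul, mul_pow, hr2, prodBasis_apply, norm_inner_symm,
      ← prodInner_eq_inner] at this
    exact mul_left_cancel₀ hlam0.ne' this
  have hμ : lambdaSq (proj χ) = ∏ j, q j (o j) := by
    rw [hb, ← hχq]
    simp only [hβ]
  have hμ0 : 0 < lambdaSq (proj χ) := lambdaSq_pos fun h0 => hχ0 (by rw [h0]; rfl)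
  -- Summing over the basis of party j replaces the factor q j (o j) of Λ²(χ) by 1; since b is
  -- optimal the sum is still at most Λ²(χ), so q j (o j) ≥ 1.
  have hq1 : ∀ j, 1 ≤ q j (o j) := by
    intro j
    have hs := sum_norm_prodInner_update_sq_le χ (fun j => (b j).1) (by simp) j (β j)
    have e : ∀ m, ‖prodInner χ (Function.update (fun j => (b j).1) j (β j m))‖ ^ 2 =
        q j m * ∏ l ∈ Finset.univ.erase j, q l (o l) := by
      intro m
      have e1 : Function.update (fun j => (b j).1) j (β j m) =
          fun l => β l (Function.update o j m l) := by
        funext l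
        by_cases hl : l = j
        · subst hl; simp
        · simp [hl, hβ]
      rw [e1, hχq, ← Finset.mul_prod_erase _ _ (Finset.mem_univ j), Function.update_self]
      congr 1
      refine Finset.prod_congr rfl fun l hl => ?_
      rw [Function.update_of_ne (Finset.ne_of_mem_erase hl)]
    simp only [e, ← Finset.sum_mul, hq, one_mul] at hs
    rw [hμ, ← Finset.mul_prod_erase _ _ (Finset.mem_univ j)] at hs hμ0
    have hP : 0 < ∏ l ∈ Finset.univ.erase j, q l (o l) := by
      refine lt_of_le_of_ne (Finset.prod_nonneg fun l _ => by positivity) fun h0 => ?_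
      rw [← h0, mul_zero] at hμ0
      exact lt_irrefl _ hμ0
    exact (le_mul_iff_one_le_left hP).1 hs
  rw [hμ]
  exact Finset.one_le_prod fun j _ => hq1 j

end Tensor

theorem sum_norm_sq_eq_one {ι : Type} [Fintype ι] {ψ : ι → ℂ}
    (h : ‖(WithLp.toLp 2 ψ : EuclideanSpace ℂ ι)‖ = 1) : ∑ i, (‖ψ i‖ : ℂ) ^ 2 = 1 := by
  have h2 := EuclideanSpace.norm_sq_eq (WithLp.toLp 2 ψ : EuclideanSpace ℂ ι)
  rw [h, one_pow] at h2
  exact_mod_cast h2.symm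

/-! ### Several copies and maximally entangled local vectors -/

section Copies

variable {N : ℕ} {κ : Fin N → Type}

/-- The `n`-th tensor power of a ket. -/
def powKet (ψ : Label κ → ℂ) (n : ℕ) : Label (fun j => Fin n → κ j) → ℂ :=
  fun i => ∏ k, ψ fun j => i j k

theorem tensorPow_proj (ψ : Label κ → ℂ) (n : ℕ) :
    tensorPow (proj ψ) n = proj (powKet ψ n) := by
  ext i i'
  simp [tensorPow, proj, powKet, Matrix.vecMulVec_apply, Finset.prod_mul_distrib]

theorem tensorKet_ne_zero {ψ χ : Label κ → ℂ} (hψ : ψ ≠ 0) (hχ : χ ≠ 0) : tensorKet ψ χ ≠ 0 := by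
  obtain ⟨i, hi⟩ := Function.ne_iff.1 hψ
  obtain ⟨i', hi'⟩ := Function.ne_iff.1 hχ
  exact Function.ne_iff.2 ⟨fun j => (i j, i' j), mul_ne_zero hi hi'⟩

theorem powKet_ne_zero {ψ : Label κ → ℂ} (hψ : ψ ≠ 0) (n : ℕ) : powKet ψ n ≠ 0 := by
  obtain ⟨i, hi⟩ := Function.ne_iff.1 hψ
  exact Function.ne_iff.2 ⟨fun j _ => i j, Finset.prod_ne_zero_iff.2 fun _ _ => hi⟩

/-- Distributivity over words cut into consecutive pairs; used for both the norm and the overlap of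
the paired witness. -/
theorem sum_prod_pairs {K R : Type*} [Fintype K] [CommSemiring R] (g : K → K → R) (m : ℕ) :
    ∑ f : Fin (m * 2) → K, ∏ k : Fin m, g (f (finProdFinEquiv (k, 0))) (f (finProdFinEquiv (k, 1))) =
      (∑ x, ∑ y, g x y) ^ m := by
  have h1 : ∑ x, ∑ y, g x y = ∑ p : Fin 2 → K, g (p 0) (p 1) := by
    rw [← Fintype.sum_prod_type']
    exact ((finTwoArrowEquiv K).sum_comp fun p => g p.1 p.2).symm
  have h2 : (∑ p : Fin 2 → K, g (p 0) (p 1)) ^ m =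
      ∏ _k : Fin m, ∑ p : Fin 2 → K, g (p 0) (p 1) := by simp
  rw [h1, h2, Finset.prod_univ_sum, Fintype.piFinset_univ]
  let e : (Fin (m * 2) → K) ≃ (Fin m → Fin 2 → K) :=
    (finProdFinEquiv.arrowCongr (Equiv.refl K)).symm.trans (Equiv.curry _ _ _)
  rw [← e.sum_comp]
  rfl

variable [∀ j, Fintype (κ j)]

theorem one_le_lambdaSq_tensorKet_star [∀ j, Nonempty (κ j)] {ψ : Label κ → ℂ}
    (h : ‖(WithLp.toLp 2 ψ : EuclideanSpace ℂ (Label κ))‖ = 1) :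
    1 ≤ lambdaSq (proj (tensorKet ψ (star ψ))) * ∏ j, (Fintype.card (κ j) : ℝ) := by
  classical
  -- The local witness is ∑ₓ |xx⟩, of squared norm equal to the local dimension.
  have := norm_prodInner_sq_le (tensorKet ψ (star ψ)) fun j =>
    WithLp.toLp 2 fun p : κ j × κ j => if p.1 = p.2 then 1 else 0
  have hn : ∀ j, ‖(WithLp.toLp 2 fun p : κ j × κ j => if p.1 = p.2 then 1 else 0 :
      EuclideanSpace ℂ (κ j × κ j))‖ ^ 2 = Fintype.card (κ j) := by
    intro j
    rw [EuclideanSpace.norm_sq_eq, Fintype.sum_prod_type]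
    simp [apply_ite]
  have hs : (prodInner (tensorKet ψ (star ψ)) fun j =>
      WithLp.toLp 2 fun p : κ j × κ j => if p.1 = p.2 then 1 else 0) = 1 := by
    rw [prodInner_apply]
    have := sum_label_prod fun (i i' : Label κ) =>
      star (ψ i * star (ψ i')) * ∏ j, if i j = i' j then (1 : ℂ) else 0
    refine Eq.trans ?_ (this.trans ?_)
    · rfl
    · have h2 := sum_norm_sq_eq_one h
      refine Eq.trans (Finset.sum_congr rfl fun i _ => ?_) h2
      rw [Finset.sum_eq_single i]
      · simp [Complex.mul_conj', mul_comm]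
      · intro i' _ hi
        obtain ⟨j, hj⟩ := Function.ne_iff.1 hi
        rw [Finset.prod_eq_zero (Finset.mem_univ j) (if_neg hj), mul_zero]
      · simp
  rw [hs] at this
  simpa only [hn, norm_one, one_pow] using this

theorem one_le_lambdaSq_powKet [∀ j, Nonempty (κ j)] {ψ : Label κ → ℂ} (hreal : star ψ = ψ)
    (h : ‖(WithLp.toLp 2 ψ : EuclideanSpace ℂ (Label κ))‖ = 1) (m : ℕ) :
    1 ≤ lambdaSq (proj (powKet ψ (m * 2))) * (∏ j, (Fintype.card (κ j) : ℝ)) ^ m := by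
  classical
  -- The local witness is ∑ₓ |xx⟩ on each of the m consecutive pairs of copies; reality of ψ makes
  -- the overlap of each pair equal to ∑ |ψᵢ|² = 1.
  have := norm_prodInner_sq_le (powKet ψ (m * 2)) fun j =>
    WithLp.toLp 2 fun f : Fin (m * 2) → κ j => ∏ k : Fin m,
      if f (finProdFinEquiv (k, 0)) = f (finProdFinEquiv (k, 1)) then 1 else 0
  have hn : ∀ j, ‖(WithLp.toLp 2 fun f : Fin (m * 2) → κ j => ∏ k : Fin m,
      if f (finProdFinEquiv (k, 0)) = f (finProdFinEquiv (k, 1)) then 1 else 0 :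
      EuclideanSpace ℂ (Fin (m * 2) → κ j))‖ ^ 2 = Fintype.card (κ j) ^ m := by
    intro j
    rw [EuclideanSpace.norm_sq_eq]
    have := sum_prod_pairs (fun x y : κ j => if x = y then (1 : ℝ) else 0) m
    simp only [Finset.sum_ite_eq, Finset.mem_univ, if_true, Finset.sum_const, Finset.card_univ,
      nsmul_eq_mul, mul_one] at this
    rw [← this]
    refine Finset.sum_congr rfl fun f _ => ?_
    rw [norm_prod, ← Finset.prod_pow]
    exact Finset.prod_congr rfl fun k _ => by split_ifs <;> simp
  have hψ : ∀ i, star (ψ i) = ψ i := fun i => congrFun hreal i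
  have hs : (prodInner (powKet ψ (m * 2)) fun j =>
      WithLp.toLp 2 fun f : Fin (m * 2) → κ j => ∏ k : Fin m,
      if f (finProdFinEquiv (k, 0)) = f (finProdFinEquiv (k, 1)) then 1 else 0) = 1 := by
    rw [prodInner_apply]
    have h3 := sum_prod_pairs (fun x y : Label κ =>
      star (ψ x) * star (ψ y) * ∏ j, if x j = y j then (1 : ℂ) else 0) m
    have h2 := sum_norm_sq_eq_one h
    have h4 : ∑ x, ∑ y, (star (ψ x) * star (ψ y) * ∏ j, if x j = y j then (1 : ℂ) else 0) = 1 := by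
      refine Eq.trans (Finset.sum_congr rfl fun i _ => ?_) h2
      rw [Finset.sum_eq_single i]
      · rw [← Complex.conj_mul', ← Complex.star_def, hψ]
        simp
      · intro i' _ hi
        obtain ⟨j, hj⟩ := Function.ne_iff.1 hi
        rw [Finset.prod_eq_zero (Finset.mem_univ j) (if_neg (Ne.symm hj)), mul_zero]
      · simp
    rw [h4, one_pow] at h3
    rw [← h3, ← (Equiv.piComm fun (j : Fin N) (_ : Fin (m * 2)) => κ j).sum_comp]
    refine Finset.sum_congr rfl fun i _ => ?_
    simp only [powKet, star_prod]
    rw [← finProdFinEquiv.prod_comp, Fintype.prod_prod_type,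
      Finset.prod_comm (s := (Finset.univ : Finset (Fin N))), ← Finset.prod_mul_distrib]
    refine Finset.prod_congr rfl fun k _ => ?_
    rw [Fin.prod_univ_two]
    rfl
  rw [hs] at this
  simpa only [hn, norm_one, one_pow, Finset.prod_pow] using this

theorem lambdaSq_powKet_two_le [∀ j, Nonempty (κ j)] (ψ : Label κ → ℂ) :
    lambdaSq (proj (powKet ψ 2)) ≤ lambdaSq (proj (tensorKet ψ ψ)) := by
  refine lambdaSq_le_iff.2 fun a => ?_
  have := norm_prodInner_sq_le (tensorKet ψ ψ) fun j =>
    WithLp.toLp 2 fun p : κ j × κ j => (a j).1 ((finTwoArrowEquiv (κ j)).symm p)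
  have hn : ∀ j, ‖(WithLp.toLp 2 fun p : κ j × κ j => (a j).1 ((finTwoArrowEquiv (κ j)).symm p) :
      EuclideanSpace ℂ (κ j × κ j))‖ ^ 2 = 1 := by
    intro j
    have h1 : ‖(a j).1‖ ^ 2 = 1 := by simp
    rw [EuclideanSpace.norm_sq_eq] at h1 ⊢
    exact ((finTwoArrowEquiv (κ j)).symm.sum_comp fun f => ‖(a j).1 f‖ ^ 2).trans h1
  have hs : (prodInner (tensorKet ψ ψ) fun j =>
      WithLp.toLp 2 fun p : κ j × κ j => (a j).1 ((finTwoArrowEquiv (κ j)).symm p)) =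
      prodInner (powKet ψ 2) fun j => (a j).1 := by
    rw [prodInner_apply, prodInner_apply,
      ← (Equiv.piCongrRight fun j => finTwoArrowEquiv (κ j)).sum_comp]
    refine Finset.sum_congr rfl fun i _ => ?_
    simp only [tensorKet, powKet, Fin.prod_univ_two]
    congr 1
    refine Finset.prod_congr rfl fun j _ => ?_
    exact congrArg (fun f => (a j).1 f) ((finTwoArrowEquiv (κ j)).symm_apply_apply (i j))
  rw [hs] at this
  simpa only [hn, Finset.prod_const_one, mul_one] using this

end Copies

/-! ### Consequences for the geometric measure -/

section Additivity

variable {N : ℕ} {κ : Fin N → Type} [∀ j, Fintype (κ j)] [∀ j, Nonempty (κ j)]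

theorem G_proj (ψ : Label κ → ℂ) : G (proj ψ) = -Real.logb 2 (lambdaSq (proj ψ)) := by
  rw [G, lambda, Real.sqrt_eq_rpow]
  -- For Λ² = 0 both sides vanish, because the logarithm of 0 is 0 by convention.
  rcases (lambdaSq_proj_nonneg ψ).eq_or_lt with h | h
  · simp [← h]
  · rw [Real.logb_rpow_eq_mul_logb_of_pos h]; ring

theorem toLp_ne_zero_of_norm_eq_one {ι : Type} [Fintype ι] {ψ : ι → ℂ}
    (h : ‖(WithLp.toLp 2 ψ : EuclideanSpace ℂ ι)‖ = 1) : ψ ≠ 0 := by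
  rintro rfl
  simp at h

theorem norm_toLp_star {ι : Type} [Fintype ι] (ψ : ι → ℂ) :
    ‖(WithLp.toLp 2 (star ψ) : EuclideanSpace ℂ ι)‖ =
      ‖(WithLp.toLp 2 ψ : EuclideanSpace ℂ ι)‖ := by
  simp [EuclideanSpace.norm_eq]

theorem isState_proj {ι : Type} [Fintype ι] {ψ : ι → ℂ}
    (h : ‖(WithLp.toLp 2 ψ : EuclideanSpace ℂ ι)‖ = 1) : IsState (proj ψ) := by
  refine ⟨Matrix.posSemidef_vecMulVec_self_star ψ, ?_⟩
  have h2 := sum_norm_sq_eq_one h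
  rw [← h2]
  simp only [Matrix.trace, Matrix.diag, proj, Matrix.vecMulVec_apply, Pi.star_apply,
    Complex.star_def, Complex.mul_conj']

theorem G_tensor_star_le {ψ : Label κ → ℂ}
    (h : ‖(WithLp.toLp 2 ψ : EuclideanSpace ℂ (Label κ))‖ = 1) :
    G (tensor (proj ψ) (proj (star ψ))) ≤ Real.logb 2 (∏ j, (Fintype.card (κ j) : ℝ)) := by
  have h0 := toLp_ne_zero_of_norm_eq_one h
  have hl : 0 < lambdaSq (proj (tensorKet ψ (star ψ))) :=
    lambdaSq_pos (tensorKet_ne_zero h0 (star_ne_zero.2 h0))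
  have hD : 0 < ∏ j, (Fintype.card (κ j) : ℝ) :=
    Finset.prod_pos fun j _ => by exact_mod_cast Fintype.card_pos
  rw [tensor_proj, G_proj, neg_le_iff_add_nonneg, add_comm, ← Real.logb_mul hl.ne' hD.ne']
  exact Real.logb_nonneg one_lt_two (one_le_lambdaSq_tensorKet_star h)

theorem G_tensorPow_le {ψ : Label κ → ℂ} (hreal : star ψ = ψ)
    (h : ‖(WithLp.toLp 2 ψ : EuclideanSpace ℂ (Label κ))‖ = 1) (m : ℕ) :
    G (tensorPow (proj ψ) (m * 2)) ≤ m * Real.logb 2 (∏ j, (Fintype.card (κ j) : ℝ)) := by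
  have h0 := toLp_ne_zero_of_norm_eq_one h
  have hl : 0 < lambdaSq (proj (powKet ψ (m * 2))) := lambdaSq_pos (powKet_ne_zero h0 _)
  have hD : 0 < ∏ j, (Fintype.card (κ j) : ℝ) :=
    Finset.prod_pos fun j _ => by exact_mod_cast Fintype.card_pos
  rw [tensorPow_proj, G_proj, neg_le_iff_add_nonneg, add_comm, ← Real.logb_pow,
    ← Real.logb_mul hl.ne' (pow_pos hD _).ne']
  exact Real.logb_nonneg one_lt_two (one_le_lambdaSq_powKet hreal h m)

theorem G_lt_G_tensor_star {ψ : Label κ → ℂ}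
    (h : ‖(WithLp.toLp 2 ψ : EuclideanSpace ℂ (Label κ))‖ = 1) (h1 : lambdaSq (proj ψ) < 1) :
    G (proj ψ) < G (tensor (proj ψ) (proj (star ψ))) := by
  have h0 := toLp_ne_zero_of_norm_eq_one h
  rw [tensor_proj, G_proj, G_proj, neg_lt_neg_iff]
  refine Real.logb_lt_logb one_lt_two
    (lambdaSq_pos (tensorKet_ne_zero h0 (star_ne_zero.2 h0))) ?_
  by_contra! hle
  have := one_le_lambdaSq_of_le_lambdaSq_tensorKet h0 ((norm_toLp_star ψ).trans h) hle
  rw [lambdaSq_star] at this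
  exact absurd h1 this.not_gt

theorem G_lt_G_tensorPow_two {ψ : Label κ → ℂ}
    (h : ‖(WithLp.toLp 2 ψ : EuclideanSpace ℂ (Label κ))‖ = 1) (h1 : lambdaSq (proj ψ) < 1) :
    G (proj ψ) < G (tensorPow (proj ψ) 2) := by
  have h0 := toLp_ne_zero_of_norm_eq_one h
  rw [tensorPow_proj, G_proj, G_proj, neg_lt_neg_iff]
  refine Real.logb_lt_logb one_lt_two (lambdaSq_pos (powKet_ne_zero h0 _)) ?_
  refine (lambdaSq_powKet_two_le ψ).trans_lt ?_
  by_contra! hle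
  exact absurd h1 (one_le_lambdaSq_of_le_lambdaSq_tensorKet h0 h hle).not_gt

theorem sqrt_inv_le_lambdaSq_of_two_mul_G_le {ψ : Label κ → ℂ} {D : ℝ} (hD : 0 < D)
    (h : ψ ≠ 0) (hG : 2 * G (proj ψ) ≤ Real.logb 2 D) : (√D)⁻¹ ≤ lambdaSq (proj ψ) := by
  have hl := lambdaSq_pos h
  rw [G_proj] at hG
  have : Real.logb 2 ((√D)⁻¹) ≤ Real.logb 2 (lambdaSq (proj ψ)) := by
    rw [Real.logb_inv, Real.sqrt_eq_rpow, Real.logb_rpow_eq_mul_logb_of_pos hD]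
    linarith
  exact (Real.logb_le_logb one_lt_two (by positivity) hl).1 this

/-- Strong additivity is tested on σ = ψ*, for which G(ψ*) = G(ψ). -/
theorem IsStrongAdditive.sqrt_inv_le_lambdaSq {d : Fin N → ℕ} (hd : ∀ j, 0 < d j)
    {ψ : (Label fun j => Fin (d j)) → ℂ}
    (h : ‖(WithLp.toLp 2 ψ : EuclideanSpace ℂ (Label fun j => Fin (d j)))‖ = 1)
    (hadd : IsStrongAdditive (proj ψ)) : (√(∏ j, (d j : ℝ)))⁻¹ ≤ lambdaSq (proj ψ) := by
  have : ∀ j, Nonempty (Fin (d j)) := fun j => ⟨⟨0, hd j⟩⟩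
  have h1 := hadd d _ (isState_proj ((norm_toLp_star ψ).trans h))
  have h2 := G_tensor_star_le h
  have h3 : G (proj (star ψ)) = G (proj ψ) := by rw [G_proj, G_proj, lambdaSq_star]
  simp only [Fintype.card_fin] at h2
  refine sqrt_inv_le_lambdaSq_of_two_mul_G_le
    (Finset.prod_pos fun j _ => by exact_mod_cast hd j) (toLp_ne_zero_of_norm_eq_one h) ?_
  linarith

theorem IsAdditive.sqrt_inv_le_lambdaSq {ψ : Label κ → ℂ} (hreal : star ψ = ψ)
    (h : ‖(WithLp.toLp 2 ψ : EuclideanSpace ℂ (Label κ))‖ = 1) (hadd : IsAdditive (proj ψ)) :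
    (√(∏ j, (Fintype.card (κ j) : ℝ)))⁻¹ ≤ lambdaSq (proj ψ) := by
  refine sqrt_inv_le_lambdaSq_of_two_mul_G_le
    (Finset.prod_pos fun j _ => by exact_mod_cast Fintype.card_pos)
    (toLp_ne_zero_of_norm_eq_one h) ?_
  -- Even powers suffice: along them the averages are at most half the logarithm of the total
  -- dimension.
  have ht : Tendsto (fun m : ℕ => m * 2) atTop atTop :=
    tendsto_id.atTop_mul_const' two_pos
  have hlim := hadd.comp ht
  have := le_of_tendsto hlim (b := Real.logb 2 (∏ j, (Fintype.card (κ j) : ℝ)) / 2) (by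
    filter_upwards [eventually_gt_atTop 0] with m hm
    have hm' : (0 : ℝ) < m := by exact_mod_cast hm
    have := G_tensorPow_le hreal h m
    simp only [Function.comp_apply]
    rw [one_div_mul_eq_div, div_le_iff₀ (by push_cast; positivity)]
    push_cast
    linarith)
  linarith

end Additivity

/-! ### Concentration of the maximal overlap -/

section Concentration

/-- `A` reads off the amplitudes of a random normalized ket with coefficients in `𝕜`. -/
structure IsAmplitude {𝕜 ι : Type} [RCLike 𝕜] [Fintype ι] (A : Ket 𝕜 ι → ι → ℂ) : Prop where
  norm_eq_one : ∀ ψ, ‖(WithLp.toLp 2 (A ψ) : EuclideanSpace ℂ ι)‖ = 1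
  exists_re_inner_eq : ∀ v : EuclideanSpace ℂ ι, ‖v‖ = 1 → ∃ u : EuclideanSpace 𝕜 ι, ‖u‖ ≤ 1 ∧
    ∀ ψ, (inner ℂ (WithLp.toLp 2 (A ψ)) v).re = RCLike.re (inner 𝕜 u ψ.1)
  mul_eq_mul : ∀ ψ a b c e, A ψ a * A ψ b = A ψ c * A ψ e → ψ.1 a * ψ.1 b = ψ.1 c * ψ.1 e

theorem isAmplitude_amp {ι : Type} [Fintype ι] : IsAmplitude (amp (ι := ι)) where
  norm_eq_one ψ := by
    have : ‖ψ.1‖ = 1 := by simp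
    exact this
  exists_re_inner_eq v hv := ⟨v, hv.le, fun ψ => inner_re_symm (𝕜 := ℂ) _ _⟩
  mul_eq_mul _ _ _ _ _ h := h

theorem isAmplitude_ampReal {ι : Type} [Fintype ι] : IsAmplitude (ampReal (ι := ι)) where
  norm_eq_one ψ := by
    have : ‖ψ.1‖ = 1 := by simp
    rw [EuclideanSpace.norm_eq] at this ⊢
    simpa [ampReal] using this
  exists_re_inner_eq v hv := by
    -- Against a real ket only Re v contributes; its norm may drop below 1, which is why the cap
    -- bound allows ‖u‖ ≤ 1.
    refine ⟨WithLp.toLp 2 fun i => (v i).re, ?_, fun ψ => ?_⟩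
    · rw [← hv, EuclideanSpace.norm_eq, EuclideanSpace.norm_eq]
      gcongr with i
      exact Complex.abs_re_le_norm _
    · rw [PiLp.inner_apply, PiLp.inner_apply, Complex.re_sum]
      simp [ampReal, mul_comm]
  mul_eq_mul _ _ _ _ _ h := by
    simp only [ampReal] at h
    exact_mod_cast h

variable {N : ℕ} {κ : Fin N → Type} [∀ j, Fintype (κ j)]

theorem norm_prodInner_sub_le {ψ : Label κ → ℂ}
    (h : ‖(WithLp.toLp 2 ψ : EuclideanSpace ℂ (Label κ))‖ = 1) (a b : LocalKets κ) {ε : ℝ}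
    (hε : 0 ≤ ε) (hab : ∀ j, ‖(a j).1 - (b j).1‖ ≤ ε) :
    ‖(prodInner ψ fun j => (a j).1) - prodInner ψ fun j => (b j).1‖ ≤ N * ε := by
  have hb := (prodInner ψ).norm_image_sub_le_of_bound zero_le_one
    (fun x => by have := norm_prodInner_le ψ x; rwa [h] at this)
    (fun j => (a j).1) (fun j => (b j).1)
  have h1 : ∀ c : LocalKets κ, ‖fun j => (c j).1‖ ≤ 1 := fun c =>
    (pi_norm_le_iff_of_nonneg zero_le_one).2 fun j => by simp
  have h2 : ‖(fun j => (a j).1) - fun j => (b j).1‖ ≤ ε :=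
    (pi_norm_le_iff_of_nonneg hε).2 hab
  refine hb.trans ?_
  rw [Fintype.card_fin, one_mul, mul_assoc]
  gcongr
  refine (mul_le_mul (pow_le_one₀ (by positivity) (max_le (h1 a) (h1 b))) h2 (norm_nonneg _)
    zero_le_one).trans_eq (one_mul _)

theorem finrank_real_euclideanSpace_complex (ι : Type) [Fintype ι] :
    Module.finrank ℝ (EuclideanSpace ℂ ι) = 2 * Fintype.card ι := by
  rw [← Module.finrank_mul_finrank ℝ ℂ, Complex.finrank_real_complex, finrank_euclideanSpace]

variable [∀ j, Nonempty (κ j)]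

/-- The maximal overlap of a random ket with product kets is small, by an `ε`-net argument. -/
theorem haarKet_lambdaSq_ge_le {𝕜 : Type} [RCLike 𝕜] {A : Ket 𝕜 (Label κ) → Label κ → ℂ}
    (hA : IsAmplitude A) (hN : 0 < N) {t c : ℝ} (ht : 0 < t) (hc : 0 < c) (hc1 : c < 1) :
    (haarKet 𝕜 (Label κ)).real {ψ | t ≤ lambdaSq (proj (A ψ))} ≤
      (1 + 2 * N / ((1 - c) * √t)) ^ (2 * ∑ j, Fintype.card (κ j)) *
        Real.exp (-(Module.finrank ℝ (EuclideanSpace 𝕜 (Label κ)) * (c ^ 2 * t) / 2)) := by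
  classical
  have hN' : (0 : ℝ) < N := by exact_mod_cast hN
  have hst : 0 < √t := Real.sqrt_pos.2 ht
  have hc' : 0 < 1 - c := by linarith
  -- Moving all N local kets to the net costs at most N ε = (1 - c) √t of overlap, so c √t remains.
  set ε : ℝ := (1 - c) * √t / N with hε
  have hε0 : 0 < ε := by positivity
  choose T hTcard hT using fun j => exists_net_sphere (E := EuclideanSpace ℂ (κ j)) hε0
  have hu := fun b : LocalKets κ => hA.exists_re_inner_eq (prodVec fun j => (b j).1)
    (by simp [norm_prodVec])
  choose u hu1 hu using hu
  have hsub : {ψ | t ≤ lambdaSq (proj (A ψ))} ⊆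
      ⋃ b ∈ Fintype.piFinset T, {ψ : Ket 𝕜 (Label κ) | c * √t ≤ RCLike.re (inner 𝕜 (u b) ψ.1)} := by
    intro ψ hψ
    obtain ⟨a, ha⟩ := exists_re_prodInner_eq hN (A ψ)
    choose b hb hab using fun j => hT j (a j)
    refine Set.mem_iUnion₂.2 ⟨b, Fintype.mem_piFinset.2 hb, ?_⟩
    have h1 := norm_prodInner_sub_le (hA.norm_eq_one ψ) a b hε0.le hab
    have h2 := (Complex.re_le_norm _).trans h1
    have h3 : N * ε = (1 - c) * √t := by rw [hε]; field_simp
    rw [Complex.sub_re, ha, h3] at h2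
    have h4 : √t ≤ √(lambdaSq (proj (A ψ))) := Real.sqrt_le_sqrt hψ
    show c * √t ≤ _
    rw [← hu, ← prodInner_eq_inner]
    linarith
  refine (measureReal_mono hsub (measure_ne_top _ _)).trans ((measureReal_biUnion_finset_le _ _).trans ?_)
  refine (Finset.sum_le_card_nsmul _ _ _ fun b _ =>
    haarKet_cap_le (hu1 b) (mul_pos hc hst)).trans ?_
  rw [nsmul_eq_mul, mul_pow, Real.sq_sqrt ht.le]
  gcongr
  rw [Fintype.card_piFinset, Nat.cast_prod, Finset.mul_sum, ← Finset.prod_pow_eq_pow_sum]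
  refine Finset.prod_le_prod (fun _ _ => by positivity) fun j _ => (hTcard j).trans_eq ?_
  rw [finrank_real_euclideanSpace_complex, hε]
  congr 2
  field_simp

/-- Such kets obey a rank-one relation among the four amplitudes obtained by changing the labels of
two parties, and this nontrivial quadratic equation has Haar measure zero. -/
theorem haarKet_one_le_lambdaSq_eq_zero {𝕜 : Type} [RCLike 𝕜]
    {A : Ket 𝕜 (Label κ) → Label κ → ℂ} (hA : IsAmplitude A) (hN : 2 ≤ N)
    (hκ : ∀ j, 2 ≤ Fintype.card (κ j)) :
    (haarKet 𝕜 (Label κ)).real {ψ | 1 ≤ lambdaSq (proj (A ψ))} = 0 := by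
  classical
  let z : Label κ := fun j => Classical.arbitrary _
  let j : Fin N := ⟨0, by omega⟩
  let l : Fin N := ⟨1, by omega⟩
  have hjl : j ≠ l := by simp [j, l]
  have : ∀ k, Nontrivial (κ k) := fun k => Fintype.one_lt_card_iff_nontrivial.1 (hκ k)
  obtain ⟨m, hm⟩ := exists_ne (z j)
  obtain ⟨n, hn⟩ := exists_ne (z l)
  have h1 : z ≠ Function.update (Function.update z j m) l n := fun h =>
    hn (by simpa using (congrFun h l).symm)
  have h2 : z ≠ Function.update z j m := fun h => hm (by simpa using (congrFun h j).symm)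
  have h3 : z ≠ Function.update z l n := fun h => hn (by simpa using (congrFun h l).symm)
  have hae := ae_haarKet_mul_ne_mul (𝕜 := 𝕜) h1 h2 h3
  rw [measureReal_eq_zero_iff]
  refine measure_mono_null (fun ψ hψ => ?_) hae
  exact not_not.2 (hA.mul_eq_mul _ _ _ _ _
    (mul_eq_mul_of_one_le_lambdaSq (hA.norm_eq_one ψ) hψ z hjl m n))

end Concentration

/-! ### Numerical estimates for the two thresholds -/

section Numerics

theorem netBound_mul_exp_lt_of_sqrt {N S : ℕ} {D r : ℝ} (hN : 1 ≤ N) (hS : 2 * N ≤ S) (hD : 1 ≤ D)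
    (hr : 0 < r) (hr1 : r ≤ 2 / 3) (h : S * Real.log (59 * N * D) ≤ r * √D) :
    (1 + 2 * N / ((1 - 5 / 6) * √((√D)⁻¹))) ^ (2 * S) * Real.exp (-(r * (25 / 24) * √D)) <
      Real.exp (-r * √D + S * Real.log (59 * N * D)) := by
  have hN' : (1 : ℝ) ≤ N := by exact_mod_cast hN
  have hS' : 2 * (N : ℝ) ≤ S := by exact_mod_cast hS
  have hD0 : 0 < D := by linarith
  set q := √(√D) with hq
  have hq1 : 1 ≤ q := Real.one_le_sqrt.2 (Real.one_le_sqrt.2 hD)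
  have hq2 : q ^ 2 = √D := Real.sq_sqrt (Real.sqrt_nonneg _)
  have hq4 : q ^ 4 = D := by
    rw [show q ^ 4 = (q ^ 2) ^ 2 by ring, hq2, Real.sq_sqrt hD0.le]
  have hbig : 3 ≤ 59 * N * D := by nlinarith
  have hpos : 0 < 59 * N * D := by linarith
  have hlog : 1 ≤ Real.log (59 * N * D) := by
    rw [Real.le_log_iff_exp_le hpos]
    linarith [Real.exp_one_lt_d9]
  -- The hypothesis makes D large against N; this trades one factor N in (13 N q)² for q²/3, giving
  -- 169/3 < 59.
  have h3N : 3 * N ≤ q ^ 2 := by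
    rw [hq2]
    have h1 : (2 * N : ℝ) * 1 ≤ S * Real.log (59 * N * D) := by gcongr
    have h2 : r * √D ≤ 2 / 3 * √D := by gcongr
    linarith
  have hbase : 1 + 2 * N / ((1 - 5 / 6) * √((√D)⁻¹)) = 1 + 12 * N * q := by
    rw [Real.sqrt_inv, ← hq]
    field_simp
    ring
  have hsq : (1 + 12 * N * q) ^ 2 ≤ 59 * N * D := by
    have h1 : 1 ≤ N * q := by nlinarith
    calc (1 + 12 * N * q) ^ 2 ≤ (13 * (N * q)) ^ 2 := by
          apply pow_le_pow_left₀ (by positivity); linarith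
      _ = 169 / 3 * (3 * N) * N * q ^ 2 := by ring
      _ ≤ 169 / 3 * q ^ 2 * N * q ^ 2 := by gcongr
      _ = 169 / 3 * N * D := by rw [← hq4]; ring
      _ ≤ 59 * N * D := by gcongr; norm_num
  rw [hbase, pow_mul, add_comm (-r * √D), Real.exp_add, ← Real.log_pow, Real.exp_log (pow_pos hpos S)]
  refine mul_lt_mul' (pow_le_pow_left₀ (by positivity) hsq S) ?_ (Real.exp_pos _).le
    (pow_pos hpos S)
  rw [Real.exp_lt_exp]
  have : 0 < r * √D := mul_pos hr (Real.sqrt_pos.2 hD0)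
  linarith

theorem netBound_mul_exp_lt_of_log {N S : ℕ} {D K : ℝ} (hN : 3 ≤ N) (hS : 2 * N ≤ S)
    (hD : 2 ^ N ≤ D) (hK : 9 / 2 ≤ K) (h : K * (S * Real.log D) / D < 1) :
    (1 + 2 * N / ((1 - 4 / 5) * √(K * (S * Real.log D) / D))) ^ (2 * S) *
      Real.exp (-(72 / 25 * (S * Real.log D))) < D ^ (-(S : ℝ)) := by
  have hN' : (3 : ℝ) ≤ N := by exact_mod_cast hN
  have hS' : 2 * (N : ℝ) ≤ S := by exact_mod_cast hS
  have hD0 : 0 < D := lt_of_lt_of_le (by positivity) hD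
  have hlogN : N * Real.log 2 ≤ Real.log D := by
    rw [← Real.log_pow]
    exact Real.log_le_log (by positivity) hD
  have hlog2 : 0.693 < Real.log 2 := by linarith [Real.log_two_gt_d9]
  have hSL : (2 * N) * (N * Real.log 2) ≤ S * Real.log D := by gcongr
  have hSL0 : 0 < S * Real.log D := lt_of_lt_of_le (by positivity) hSL
  have hKS : 9 / 2 * (S * Real.log D) ≤ K * (S * Real.log D) := by gcongr
  set t := K * (S * Real.log D) / D with ht
  have htD : t * D = K * (S * Real.log D) := by rw [ht]; field_simp
  have ht0 : 0 < t := by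
    have : 0 < t * D := by rw [htD]; linarith
    exact pos_of_mul_pos_left this hD0.le
  have h6 : 6 * (N : ℝ) ^ 2 ≤ t * D := by
    rw [htD]
    refine le_trans ?_ hKS
    nlinarith [sq_nonneg (N : ℝ)]
  have hD54 : 54 < D := by
    have h1 : t * D < D := by nlinarith
    nlinarith
  have hst : 0 < √t := Real.sqrt_pos.2 ht0
  set x := N / √t with hx
  have hx0 : 0 ≤ x := by positivity
  have hx2 : 6 * x ^ 2 ≤ D := by
    rw [hx, div_pow, Real.sq_sqrt ht0.le, mul_div_assoc', div_le_iff₀ ht0]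
    linarith
  have hbase : 1 + 2 * N / ((1 - 4 / 5) * √t) = 1 + 10 * x := by
    rw [hx]
    field_simp
    ring
  have hsq : (1 + 10 * x) ^ 2 ≤ 18 * D := by nlinarith [sq_nonneg (x - 3)]
  have hlogD : Real.log 2 + 3 * Real.log 3 ≤ Real.log D := by
    have : Real.log 54 ≤ Real.log D := Real.log_le_log (by norm_num) hD54.le
    rwa [show (54 : ℝ) = 2 * 3 ^ 3 by norm_num, Real.log_mul (by norm_num) (by norm_num),
      Real.log_pow, Nat.cast_ofNat] at this
  have hlog18 : Real.log (18 * D) = Real.log 2 + 2 * Real.log 3 + Real.log D := by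
    rw [show (18 : ℝ) = 2 * 3 ^ 2 by norm_num, Real.log_mul (by norm_num) hD0.ne',
      Real.log_mul (by norm_num) (by norm_num), Real.log_pow, Nat.cast_ofNat]
  have hlog23 : Real.log 2 < Real.log 3 := Real.log_lt_log (by norm_num) (by norm_num)
  have hS0 : (0 : ℝ) < S := by linarith
  -- Amounts to ln 18 < (22/25) ln D, which D > 54 ensures.
  have hfinal : S * Real.log (18 * D) + -(72 / 25 * (S * Real.log D)) < Real.log D * -S := by
    rw [hlog18]
    nlinarith
  rw [hbase, pow_mul, Real.rpow_def_of_pos hD0]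
  calc ((1 + 10 * x) ^ 2) ^ S * Real.exp (-(72 / 25 * (S * Real.log D)))
      ≤ (18 * D) ^ S * Real.exp (-(72 / 25 * (S * Real.log D))) := by gcongr
    _ = Real.exp (S * Real.log (18 * D) + -(72 / 25 * (S * Real.log D))) := by
        rw [Real.exp_add, ← Real.log_pow (18 * D) S, Real.exp_log (by positivity)]
    _ < _ := Real.exp_lt_exp.2 hfinal

end Numerics

/-! ### Probability bounds for typical kets -/

section Typical

variable {N : ℕ} {κ : Fin N → Type} [∀ j, Fintype (κ j)]

/-- Uses subadditivity only, so neither set has to be measurable. -/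
theorem one_sub_lt_measureReal_of_compl_lt {Ω : Type*} [MeasurableSpace Ω] {μ : Measure Ω}
    [IsProbabilityMeasure μ] {S T : Set Ω} {p : ℝ} (hT : μ.real T < p) (hST : ∀ x, x ∉ T → x ∈ S) :
    μ.real S > 1 - p := by
  have h1 : μ.real (S ∪ T) = 1 := by
    have : S ∪ T = Set.univ := Set.eq_univ_of_forall fun x => by
      by_cases h : x ∈ T
      · exact Or.inr h
      · exact Or.inl (hST x h)
    rw [this, probReal_univ]
  have h2 := measureReal_union_le (μ := μ) S T
  linarith

theorem two_mul_le_sum_card (hκ : ∀ j, 2 ≤ Fintype.card (κ j)) :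
    2 * N ≤ ∑ j, Fintype.card (κ j) := by
  have := Finset.card_nsmul_le_sum Finset.univ (fun j => Fintype.card (κ j)) 2 fun j _ => hκ j
  simpa [mul_comm] using this

theorem two_pow_le_prod_card (hκ : ∀ j, 2 ≤ Fintype.card (κ j)) :
    (2 : ℝ) ^ N ≤ ∏ j, (Fintype.card (κ j) : ℝ) := by
  have := Finset.prod_le_prod (s := Finset.univ) (f := fun _ : Fin N => (2 : ℝ))
    (g := fun j => (Fintype.card (κ j) : ℝ)) (fun _ _ => by norm_num)
    fun j _ => by exact_mod_cast hκ j
  simpa using this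

theorem nonempty_of_two_le_card (hκ : ∀ j, 2 ≤ Fintype.card (κ j)) (j : Fin N) :
    Nonempty (κ j) :=
  Fintype.card_pos_iff.1 (by have := hκ j; omega)

variable {𝕜 : Type} [RCLike 𝕜] {A : Ket 𝕜 (Label κ) → Label κ → ℂ}

theorem haarKet_sqrt_inv_le_lambdaSq_lt (hA : IsAmplitude A) (hN : 1 ≤ N)
    (hκ : ∀ j, 2 ≤ Fintype.card (κ j)) {r : ℝ} (hr : 0 < r) (hr1 : r ≤ 2 / 3)
    (hdim : (Module.finrank ℝ (EuclideanSpace 𝕜 (Label κ)) : ℝ) =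
      3 * r * ∏ j, (Fintype.card (κ j) : ℝ)) :
    (haarKet 𝕜 (Label κ)).real
        {ψ | (√(∏ j, (Fintype.card (κ j) : ℝ)))⁻¹ ≤ lambdaSq (proj (A ψ))} <
      Real.exp (-r * √(∏ j, (Fintype.card (κ j) : ℝ)) +
        (∑ j, Fintype.card (κ j) : ℕ) *
          Real.log (59 * N * ∏ j, (Fintype.card (κ j) : ℝ))) := by
  have := nonempty_of_two_le_card hκ
  have hS := two_mul_le_sum_card hκ
  have hD := (one_le_pow₀ one_le_two).trans (two_pow_le_prod_card hκ)
  set D := ∏ j, (Fintype.card (κ j) : ℝ)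
  set S := ∑ j, Fintype.card (κ j)
  have hD0 : 0 < D := by linarith
  rcases lt_or_ge (r * √D) (S * Real.log (59 * N * D)) with h | h
  -- In this range the claimed bound exceeds 1.
  · refine measureReal_le_one.trans_lt (Real.one_lt_exp_iff.2 ?_)
    linarith
  · refine lt_of_le_of_lt ?_ (netBound_mul_exp_lt_of_sqrt hN hS hD hr hr1 h)
    -- With c = 5/6 the tail exponent is (25/24) r √D; the spare r √D / 24 makes the inequality
    -- strict.
    refine (haarKet_lambdaSq_ge_le hA hN (inv_pos.2 (Real.sqrt_pos.2 hD0))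
      (c := 5 / 6) (by norm_num) (by norm_num)).trans_eq ?_
    congr 2
    rw [hdim]
    have h1 : D * (√D)⁻¹ = √D := by
      rw [← div_eq_mul_inv, Real.div_sqrt]
    linear_combination (-(25 / 24) * r) * h1

theorem haarKet_lambdaSq_large_lt (hA : IsAmplitude A) (hN : 3 ≤ N)
    (hκ : ∀ j, 2 ≤ Fintype.card (κ j)) {K : ℝ} (hK : 9 / 2 ≤ K)
    (hdim : (Module.finrank ℝ (EuclideanSpace 𝕜 (Label κ)) : ℝ) * K =
      9 * ∏ j, (Fintype.card (κ j) : ℝ)) :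
    (haarKet 𝕜 (Label κ)).real
        {ψ | K * ((∑ j, Fintype.card (κ j) : ℕ) * Real.log (∏ j, (Fintype.card (κ j) : ℝ))) /
          (∏ j, (Fintype.card (κ j) : ℝ)) < lambdaSq (proj (A ψ)) ∨ 1 ≤ lambdaSq (proj (A ψ))} <
      (∏ j, (Fintype.card (κ j) : ℝ)) ^ (-((∑ j, Fintype.card (κ j) : ℕ) : ℝ)) := by
  have := nonempty_of_two_le_card hκ
  have hS := two_mul_le_sum_card hκ
  have hD := two_pow_le_prod_card hκ
  set D := ∏ j, (Fintype.card (κ j) : ℝ)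
  set S := ∑ j, Fintype.card (κ j)
  have hD1 : 1 < D := (one_lt_pow₀ one_lt_two (by omega)).trans_le hD
  have hD0 : 0 < D := by linarith
  set t := K * (S * Real.log D) / D with ht
  have hS0 : (0 : ℝ) < S := by
    have : 0 < S := by omega
    exact_mod_cast this
  have ht0 : 0 < t := by
    have := Real.log_pos hD1
    positivity
  rcases lt_or_ge t 1 with h | h
  · refine lt_of_le_of_lt ?_ (netBound_mul_exp_lt_of_log hN hS hD hK h)
    have hsub : {ψ | t < lambdaSq (proj (A ψ)) ∨ 1 ≤ lambdaSq (proj (A ψ))} ⊆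
        {ψ | t ≤ lambdaSq (proj (A ψ))} := fun ψ hψ =>
      hψ.elim le_of_lt fun h1 => h.le.trans h1
    refine (measureReal_mono hsub (measure_ne_top _ _)).trans ?_
    -- With c = 4/5 and dimension times K equal to 9D, the tail exponent is (16/25)(9/2) S ln D =
    -- (72/25) S ln D.
    refine (haarKet_lambdaSq_ge_le hA (by omega) ht0
      (c := 4 / 5) (by norm_num) (by norm_num)).trans_eq ?_
    congr 2
    have h1 : t * D = K * (S * Real.log D) := by rw [ht]; field_simp
    have h2 : Module.finrank ℝ (EuclideanSpace 𝕜 (Label κ)) * t = 9 * (S * Real.log D) := by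
      apply mul_right_cancel₀ hD0.ne'
      linear_combination (Module.finrank ℝ (EuclideanSpace 𝕜 (Label κ)) : ℝ) * h1 +
        (S * Real.log D) * hdim
    linear_combination (-8 / 25) * h2
  -- For t ≥ 1 the event lies in the null set of product kets.
  · have hsub : {ψ | t < lambdaSq (proj (A ψ)) ∨ 1 ≤ lambdaSq (proj (A ψ))} ⊆
        {ψ | 1 ≤ lambdaSq (proj (A ψ))} := fun ψ hψ => hψ.elim (fun h1 => (h.trans h1.le)) id
    refine (measureReal_mono hsub (measure_ne_top _ _)).trans_lt ?_
    rw [haarKet_one_le_lambdaSq_eq_zero hA (by omega) hκ]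
    exact Real.rpow_pos_of_pos hD0 _

theorem logb_sub_le_G [∀ j, Nonempty (κ j)] {ψ : Label κ → ℂ} (hψ : ψ ≠ 0) {D L K : ℝ} (hD : 0 < D)
    (hL : 0 < L) (hK : 0 < K) (h : lambdaSq (proj ψ) ≤ K * L / D) :
    Real.logb 2 D - Real.logb 2 L - Real.logb 2 K ≤ G (proj ψ) := by
  have := Real.logb_le_logb_of_le one_lt_two (lambdaSq_pos hψ) h
  rw [Real.logb_div (by positivity) hD.ne', Real.logb_mul hK.ne' hL.ne'] at this
  rw [G_proj]
  linarith

end Typical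

end GeometricMeasure

/-! ### The four probability bounds -/

open GeometricMeasure
theorem theorem4 (N : ℕ) (hN : 3 ≤ N) (d : Fin N → ℕ) (hd : ∀ j, 2 ≤ d j)
    (dT dS : ℝ) (hdT : dT = ∏ j, (d j : ℝ)) (hdS : dS = ∑ j, (d j : ℝ)) :
    -- complex kets: strong additivity of `G`
    (haarKet ℂ (Label fun j => Fin (d j))).real {ψ | IsStrongAdditive (proj (amp ψ))}
        < Real.exp (-(2 / 3) * √dT + dS * Real.log (59 * N * dT)) ∧
    -- complex kets: `G` of `|ψ⟩` and of `|ψ⟩ ⊗ |ψ*⟩`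
    (haarKet ℂ (Label fun j => Fin (d j))).real
        {ψ | Real.logb 2 dT - Real.logb 2 (dS * Real.log dT) - Real.logb 2 (9 / 2)
              ≤ G (proj (amp ψ)) ∧
            G (proj (amp ψ)) < G (tensor (proj (amp ψ)) (proj (star (amp ψ)))) ∧
            G (tensor (proj (amp ψ)) (proj (star (amp ψ)))) ≤ Real.logb 2 dT}
        > 1 - dT ^ (-dS) ∧
    -- real kets: additivity of `G`
    (haarKet ℝ (Label fun j => Fin (d j))).real {ψ | IsAdditive (proj (ampReal ψ))}
        < Real.exp (-(1 / 3) * √dT + dS * Real.log (59 * N * dT)) ∧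
    -- real kets: `G` of one copy and of two copies
    (haarKet ℝ (Label fun j => Fin (d j))).real
        {ψ | Real.logb 2 dT - Real.logb 2 (dS * Real.log dT) - Real.logb 2 9
              ≤ G (proj (ampReal ψ)) ∧
            G (proj (ampReal ψ)) < G (tensorPow (proj (ampReal ψ)) 2) ∧
            G (tensorPow (proj (ampReal ψ)) 2) ≤ Real.logb 2 dT}
        > 1 - dT ^ (-dS) := by
  have hκ : ∀ j, 2 ≤ Fintype.card (Fin (d j)) := by simpa using hd
  have : ∀ j, Nonempty (Fin (d j)) := nonempty_of_two_le_card hκ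
  have hTκ : ∏ j, (Fintype.card (Fin (d j)) : ℝ) = dT := by simp [hdT]
  have hSκ : ((∑ j, Fintype.card (Fin (d j)) : ℕ) : ℝ) = dS := by simp [hdS]
  have hdT1 : 1 < dT := by
    rw [← hTκ]
    exact (one_lt_pow₀ one_lt_two (by omega)).trans_le (two_pow_le_prod_card hκ)
  have hdT0 : 0 < dT := by linarith
  have hdS0 : 0 < dS := by
    have : 0 < ∑ j, Fintype.card (Fin (d j)) :=
      lt_of_lt_of_le (by omega) (two_mul_le_sum_card hκ)
    rw [← hSκ]
    exact_mod_cast this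
  have hL : 0 < dS * Real.log dT := mul_pos hdS0 (Real.log_pos hdT1)
  have hdimℝ : (Module.finrank ℝ (EuclideanSpace ℝ (Label fun j => Fin (d j))) : ℝ) = dT := by
    simp [hdT, Fintype.card_pi]
  have hdimℂ : (Module.finrank ℝ (EuclideanSpace ℂ (Label fun j => Fin (d j))) : ℝ) = 2 * dT := by
    rw [finrank_real_euclideanSpace_complex]
    simp [hdT, Fintype.card_pi]
  have hℂ := isAmplitude_amp (ι := Label fun j => Fin (d j))
  have hℝ := isAmplitude_ampReal (ι := Label fun j => Fin (d j))
  refine ⟨?_, ?_, ?_, ?_⟩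
  · have h := haarKet_sqrt_inv_le_lambdaSq_lt hℂ (by omega) hκ (r := 2 / 3) (by norm_num) le_rfl
      (by rw [hdimℂ, hTκ]; ring)
    rw [hTκ, hSκ] at h
    refine (measureReal_mono (fun ψ hψ => ?_) (measure_ne_top _ _)).trans_lt h
    have := IsStrongAdditive.sqrt_inv_le_lambdaSq (fun j => by have := hd j; omega)
      (hℂ.norm_eq_one ψ) hψ
    rwa [← hdT] at this
  · have h := haarKet_lambdaSq_large_lt hℂ hN hκ (K := 9 / 2) le_rfl
      (by rw [hdimℂ, hTκ]; ring)
    rw [hTκ, hSκ] at h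
    refine one_sub_lt_measureReal_of_compl_lt h fun ψ hψ => ?_
    obtain ⟨h1, h2⟩ := not_or.1 hψ
    have hn := hℂ.norm_eq_one ψ
    refine ⟨logb_sub_le_G (toLp_ne_zero_of_norm_eq_one hn) hdT0 hL (by norm_num) (not_lt.1 h1),
      G_lt_G_tensor_star hn (not_le.1 h2), ?_⟩
    rw [← hTκ]
    exact G_tensor_star_le hn
  · have h := haarKet_sqrt_inv_le_lambdaSq_lt hℝ (by omega) hκ (r := 1 / 3) (by norm_num)
      (by norm_num) (by rw [hdimℝ, hTκ]; ring)
    rw [hTκ, hSκ] at h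
    refine (measureReal_mono (fun ψ hψ => ?_) (measure_ne_top _ _)).trans_lt h
    have := IsAdditive.sqrt_inv_le_lambdaSq (funext fun i => Complex.conj_ofReal _)
      (hℝ.norm_eq_one ψ) hψ
    rwa [hTκ] at this
  · have h := haarKet_lambdaSq_large_lt hℝ hN hκ (K := 9) (by norm_num)
      (by rw [hdimℝ, hTκ]; ring)
    rw [hTκ, hSκ] at h
    refine one_sub_lt_measureReal_of_compl_lt h fun ψ hψ => ?_
    obtain ⟨h1, h2⟩ := not_or.1 hψ
    have hn := hℝ.norm_eq_one ψ
    refine ⟨logb_sub_le_G (toLp_ne_zero_of_norm_eq_one hn) hdT0 hL (by norm_num) (not_lt.1 h1),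
      G_lt_G_tensorPow_two hn (not_le.1 h2), ?_⟩
    -- The case of a single pair of copies.
    have := G_tensorPow_le (ψ := ampReal ψ) (funext fun i => Complex.conj_ofReal _) hn 1
    rwa [hTκ, Nat.cast_one, one_mul, one_mul] at this
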